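/- Let $\underline p=(p_k)_{k\ge 2}$ be a probability distribution on $\{2,3,\dots\}$ with $p_k=0$ for all $k>\Delta$, for some $\Delta\in\mathbb N_+$; set $p_1=0$ and $q_k=\sum_{l\ge k}p_l$. The Poisson weighted infinite tree (PWIT) has the finite strings of positive integers as vertices; its root is the empty string $\varnothing$, and the children of a vertex $\mathbf i$ are $\mathbf i j$, $j\ge 1$. For each vertex $\mathbf i$ the labels $\tau^{\mathbf i1}<\tau^{\mathbf i2}<\cdots$ of the edges from $\mathbf i$ to its children are the points of a unit intensity Poisson point process on $[0,\infty)$, each vertex $\mathbf i$ has a degree constraint $d(\mathbf i)$ with distribution $\underline p$, and all these point processes and degree constraints are independent. In the random degree constrained process (RDCP) on the PWIT each edge is activated at the time given by its label, and it is added at that time if and only if, right before that time, the degrees of both of its endpoints in the graph of the edges added so far are strictly less than their degree constraints. A vertex saturates when its degree reaches its degree constraint. The phantom saturation time $T_{\mathbf i}$ of $\mathbf i$ is the time at which $\mathbf i$ saturates in the RDCP run on the subtree formed by $\mathbf i$ and its descendants ($T_{\mathbf i}=\infty$ if it never does); in particular $T_\varnothing$ is the saturation time of the root. Claim. Almost surely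 these rules determine the set of added edges uniquely, so that $T_\varnothing$ is an almost surely well-defined random variable with values in $[0,\infty]$. It is almost surely finite, but $\mathbb E(T_\varnothing)=\infty$. Moreover, the initial value problem $$\lambda'(t)=e^{-\lambda(t)}\sum_{k=0}^{\Delta-1}\frac{\lambda(t)^k}{k!}\,q_{k+1}\quad(t\ge 0),\qquad \lambda(0)=0,$$ has a unique solution $\lambda$ on $[0,\infty)$ (with one-sided derivatives at $0$), this solution is twice differentiable, and $T_\varnothing$ has a probability density function $f$ on $[0,\infty)$ such that for all $t\ge 0$ $$f(t)=-\lambda''(t)=\lambda'(t)\,e^{-\lambda(t)}\sum_{k=0}^{\infty}\frac{\lambda(t)^k}{k!}\,p_{k+1}=\lambda'(t)\sum_{k=0}^\infty z_k^t,\qquad z_k^t:=e^{-\lambda(t)}\,\frac{\lambda(t)^k}{k!}\,p_{k+1}.$$ -/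

import Mathlib

open MeasureTheory ProbabilityTheory Set
open scoped ENNReal NNReal

namespace PWIT

/-! ### The tree

Vertices are finite strings; the children of `i` are numbered by `ℕ` (starting from `0`), so the
`(j+1)`-st child of `i` is `i ++ [j]`.  The root is `[]`.  The edge between `i` and its child
`i ++ [j]` is written `(i, j)`. -/

/-- Vertices of the infinite tree: finite strings. -/
abbrev Vertex := List ℕ

/-- Edges of the infinite tree: `(i, j)` is the edge between `i` and `i ++ [j]`. -/
abbrev Edge := Vertex × ℕ

/-- The vertex `v` is an endpoint of the edge `e`. -/
def Incident (v : Vertex) (e : Edge) : Prop := v = e.1 ∨ v = e.1 ++ [e.2]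

/-! ### The random degree constrained process for given labels and constraints -/

/-- The degree of `v`, right before time `t`, in the graph evolution in which each edge `e ∈ E`
is added at time `X e` (and no other edge is ever added). -/
noncomputable def degreeBefore (X : Edge → ℝ) (E : Set Edge) (v : Vertex) (t : ℝ) : ℕ∞ :=
  {e | e ∈ E ∧ Incident v e ∧ X e < t}.encard

/-- The degree of `v` at time `t` in that graph evolution. -/
noncomputable def degreeAt (X : Edge → ℝ) (E : Set Edge) (v : Vertex) (t : ℝ) : ℕ∞ :=
  {e | e ∈ E ∧ Incident v e ∧ X e ≤ t}.encard

/-- `E` is the set of all edges that are ever added when the process is run with activation times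
`X` and degree constraints `d`: an edge is added (at its activation time) if and only if, right
before its activation time, the degrees of both of its endpoints are strictly less than their
degree constraints. -/
def IsRDCP (X : Edge → ℝ) (d : Vertex → ℕ) (E : Set Edge) : Prop :=
  ∀ e : Edge, e ∈ E ↔ ∀ v, Incident v e → degreeBefore X E v (X e) < d v

/-- The set of edges ever added in the process with activation times `X` and constraints `d`.
When there is exactly one set `E` with `IsRDCP X d E`, it is that set. -/
def rdcpEdges (X : Edge → ℝ) (d : Vertex → ℕ) : Set Edge := ⋃₀ {E | IsRDCP X d E}

theorem rdcpEdges_eq {X : Edge → ℝ} {d : Vertex → ℕ} (h : ∃! E, IsRDCP X d E) {E : Set Edge}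
    (hE : IsRDCP X d E) : rdcpEdges X d = E := by
  have : {E' | IsRDCP X d E'} = {E} := by
    ext E'
    exact ⟨fun h' => h.unique h' hE, fun h' => by rw [mem_singleton_iff.1 h']; exact hE⟩
  rw [rdcpEdges, this, sUnion_singleton]

/-- The time when `v` saturates, i.e. when its degree reaches `d v`; it is `⊤` if `v` never
saturates. -/
noncomputable def saturationTime (X : Edge → ℝ) (d : Vertex → ℕ) (v : Vertex) : ℝ≥0∞ :=
  sInf {s : ℝ≥0∞ | ∃ t : ℝ≥0, s = t ∧ degreeAt X (rdcpEdges X d) v t = d v}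

/-- The phantom saturation time of `i`: the saturation time of the root in the process run on the
subtree consisting of `i` and its descendants, re-rooted at `i`. -/
noncomputable def phantomSaturationTime (X : Edge → ℝ) (d : Vertex → ℕ) (i : Vertex) : ℝ≥0∞ :=
  saturationTime (fun e => X (i ++ e.1, e.2)) (fun v => d (i ++ v)) []

/-! ### The random input -/

variable {Ω : Type*} [MeasurableSpace Ω]

/-- The waiting times between consecutive terms of a sequence, starting from time `0`. -/
def waitingTime (τ : ℕ → Ω → ℝ) : ℕ → Ω → ℝ
  | 0 => τ 0
  | j + 1 => fun ω => τ (j + 1) ω - τ j ω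

/-- `τ 0, τ 1, …` are the points, in increasing order, of a unit intensity Poisson point process
on `[0, ∞)`: the waiting times are i.i.d. exponential random variables of rate `1`. -/
structure IsUnitPPP (τ : ℕ → Ω → ℝ) (P : Measure Ω) : Prop where
  measurable : ∀ j, Measurable (τ j)
  law : ∀ j, P.map (waitingTime τ j) = expMeasure 1
  indep : iIndepFun (waitingTime τ) P

/-- `p` is a probability distribution on `{2, 3, …}` with `p k = 0` for `k > Δ`. -/
structure IsDegreeDistribution (p : ℕ → ℝ) (Δ : ℕ) : Prop where
  nonneg : ∀ k, 0 ≤ p k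
  lower : ∀ k, k < 2 → p k = 0
  upper : ∀ k, Δ < k → p k = 0
  sum_eq_one : HasSum p 1

/-- The Poisson weighted infinite tree, decorated with i.i.d. degree constraints: the label of the
edge `(i, j)` is `τ i j`, for each vertex `i` the labels `τ i 0 < τ i 1 < …` form a unit intensity
Poisson point process, the degree constraint `d i` of each vertex has distribution `p`, and all
these point processes and degree constraints are independent. -/
structure IsDecoratedPWIT (p : ℕ → ℝ) (d : Vertex → Ω → ℕ) (τ : Vertex → ℕ → Ω → ℝ)
    (P : Measure Ω) : Prop where
  ppp : ∀ i, IsUnitPPP (τ i) P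
  measurable_d : ∀ i, Measurable (d i)
  law_d : ∀ i k, P (d i ⁻¹' {k}) = ENNReal.ofReal (p k)
  indep_vertex : ∀ i, IndepFun (d i) (fun ω j => τ i j ω) P
  indep : iIndepFun (fun i ω => (d i ω, fun j => τ i j ω)) P

/-- The phantom saturation time of the vertex `i`, as a random variable. -/
noncomputable def phantomTime (d : Vertex → Ω → ℕ) (τ : Vertex → ℕ → Ω → ℝ) (i : Vertex)
    (ω : Ω) : ℝ≥0∞ :=
  phantomSaturationTime (fun e => τ e.1 e.2 ω) (fun v => d v ω) i

/-! ### The initial value problem -/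

/-- `q k = ∑_{l ≥ k} p l`. -/
noncomputable def q (p : ℕ → ℝ) (k : ℕ) : ℝ := ∑' l : ℕ, p (k + l)

/-- `lam : [0, ∞) → ℝ` solves the initial value problem `lam 0 = 0`,
`lam' t = exp (-lam t) * ∑_{k < Δ} (lam t) ^ k / k! * q (k + 1)`
(the values of `lam` at negative times are irrelevant). -/
def SolvesIVP (p : ℕ → ℝ) (Δ : ℕ) (lam : ℝ → ℝ) : Prop :=
  lam 0 = 0 ∧ ∀ t, 0 ≤ t → HasDerivWithinAt lam
    (Real.exp (-lam t) * ∑ k ∈ Finset.range Δ, lam t ^ k / (k.factorial : ℝ) * q p (k + 1))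
    (Ici 0) t

/-- `z_k^t = exp (-lam t) * (lam t) ^ k / k! * p (k + 1)`. -/
noncomputable def z (p : ℕ → ℝ) (lam : ℝ → ℝ) (t : ℝ) (k : ℕ) : ℝ :=
  Real.exp (-lam t) * (lam t ^ k / (k.factorial : ℝ)) * p (k + 1)

end PWIT

/-! The proof rests on a fixed-point equation at the root. The root is unsaturated right before `y`
iff fewer than `d []` of its children `k` have label below `y` and are themselves unsaturated, in
their own subtrees, right before that label: while the root still has room, nothing else can refuse
the edge. The child subtrees are i.i.d. and independent of the labels, so these children form a
thinned Poisson process. Let `G s` be the probability that the root is unsaturated right before time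
`s`, and let `H y = ∫ s in 0..y, G s`. The number of such children is then Poisson with mean `H y`
(`measure_encard_lt`). Averaging over the degree constraint gives `G y = rate p Δ (H y)`, that is
`H' = rate p Δ ∘ H` with `H 0 = 0`, so `H` is `lam` and `P (T ≥ y) = lam' y`.

The rest is calculus. As `rate` is positive on `[0, ∞)`, `lam` grows to infinity, and since `rate`
tends to `0` at infinity, so does the tail `lam'`. Hence `T` is a.s. finite with density `-lam''`,
and its mean is `∫ lam' = lim lam = ∞`. Differentiating `rate` turns the `q k` into the `p k`,
because `q k - q (k + 1) = p k`.

Both well-definedness and the recursion need control of long chains of dependence. A downward path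
of `n` edges with decreasing labels below `y` exists with probability at most `y ^ n / n!`
(`pathProb_le`), so a.s. the lengths of such paths from any given vertex are bounded. Then the
relation "adjacent and earlier" on edges is well founded and determines the added edges
(`existsUnique_isRDCP`), and the process truncated at a deep enough generation is exact at the root
(`unsat_iff`). The truncated probabilities satisfy the recursion by induction, and
`exists_solvesIntegral` passes to the limit. -/

namespace PWIT

/-! ### Splitting infinite product measures -/

/-- Under an infinite product measure, the coordinate `i` is independent of the coordinates in the
range of `f`, if `i` is not in that range. -/
theorem map_infinitePi_eval_prod_comp {ι κ X : Type*} [MeasurableSpace X] (ν : Measure X)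
    [IsProbabilityMeasure ν] {i : ι} {f : κ → ι} (hf : Function.Injective f) (hi : ∀ k, f k ≠ i) :
    (Measure.infinitePi fun _ : ι => ν).map (fun a => (a i, fun k => a (f k))) =
      ν.prod (Measure.infinitePi fun _ : κ => ν) := by
  have hind : IndepFun (fun a : ι → X => a i) (fun a k => a (f k))
      (Measure.infinitePi fun _ : ι => ν) := by
    have h := indep_iSup_of_disjoint (S := {i}) (T := {i}ᶜ)
      (m := fun j : ι => MeasurableSpace.comap (fun a : ι → X => a j) inferInstance)
      (fun j => (measurable_pi_apply j).comap_le)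
      (iIndepFun_infinitePi (P := fun _ : ι => ν) (X := fun _ x => x) (by fun_prop))
      disjoint_compl_right
    refine indep_of_indep_of_le_left (indep_of_indep_of_le_right h ?_) ?_
    · rw [MeasurableSpace.comap_le_iff_le_map]
      intro s hs
      have : Measurable[⨆ j ∈ ({i}ᶜ : Set ι),
          MeasurableSpace.comap (fun a : ι → X => a j) inferInstance]
          (fun (a : ι → X) (k : κ) => a (f k)) := by
        refine @measurable_pi_lambda _ _ _ (_) _ _ fun k => ?_
        rw [measurable_iff_comap_le]
        exact le_iSup₂_of_le (f := fun j (_ : j ∈ ({i}ᶜ : Set ι)) =>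
          MeasurableSpace.comap (fun a : ι → X => a j) inferInstance) (f k) (hi k) le_rfl
      exact this hs
    · exact le_iSup₂_of_le (f := fun j (_ : j ∈ ({i} : Set ι)) =>
          MeasurableSpace.comap (fun a : ι → X => a j) inferInstance) i rfl le_rfl
  rw [hind.map_prod_eq_prod_map_map (Measurable.aemeasurable (by fun_prop))
    (Measurable.aemeasurable (by fun_prop)), Measure.infinitePi_map_eval,
    Measure.map_infinitePi_infinitePi_of_inj (P := fun _ : ι => ν) hf]

theorem measurePreserving_head_tail {X : Type*} [MeasurableSpace X] (ν : Measure X)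
    [IsProbabilityMeasure ν] :
    MeasurePreserving (fun w : ℕ → X => (w 0, fun n => w (n + 1)))
      (Measure.infinitePi fun _ => ν) (ν.prod (Measure.infinitePi fun _ => ν)) :=
  ⟨by fun_prop, map_infinitePi_eval_prod_comp ν (add_left_injective 1) (by simp)⟩

theorem lintegral_head_tail {X : Type*} [MeasurableSpace X] (ν : Measure X)
    [IsProbabilityMeasure ν] {F : X → (ℕ → X) → ℝ≥0∞} (hF : Measurable fun p : _ × _ => F p.1 p.2) :
    ∫⁻ w, F (w 0) (fun n => w (n + 1)) ∂(Measure.infinitePi fun _ => ν) =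
      ∫⁻ x, ∫⁻ w, F x w ∂(Measure.infinitePi fun _ => ν) ∂ν := by
  rw [← lintegral_prod _ hF.aemeasurable, ← (measurePreserving_head_tail ν).lintegral_comp hF]

/-- Peels off the first waiting time together with the first mark; the remaining sequences have the
original law. This is the renewal step behind `measure_countIs_succ`. -/
theorem lintegral_head_tail_prod {X Y : Type*} [MeasurableSpace X] [MeasurableSpace Y]
    (ν : Measure X) (μ : Measure Y) [IsProbabilityMeasure ν] [IsProbabilityMeasure μ]
    {F : X → Y → (ℕ → X) → (ℕ → Y) → ℝ≥0∞}
    (hF : Measurable fun p : X × Y × (ℕ → X) × (ℕ → Y) => F p.1 p.2.1 p.2.2.1 p.2.2.2) :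
    ∫⁻ p, F (p.1 0) (p.2 0) (fun n => p.1 (n + 1)) (fun n => p.2 (n + 1))
        ∂((Measure.infinitePi fun _ => ν).prod (Measure.infinitePi fun _ => μ)) =
      ∫⁻ x, ∫⁻ y, ∫⁻ p, F x y p.1 p.2
        ∂((Measure.infinitePi fun _ => ν).prod (Measure.infinitePi fun _ => μ)) ∂μ ∂ν := by
  have m1 : ∀ w : ℕ → X, Measurable fun p : Y × (ℕ → Y) =>
      F (w 0) p.1 (fun n => w (n + 1)) p.2 := fun w =>
    hF.comp (f := fun p : Y × (ℕ → Y) => (w 0, p.1, (fun n => w (n + 1)), p.2)) (by fun_prop)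
  have m2 : Measurable fun q : (ℕ → X) × (ℕ → Y) =>
      F (q.1 0) (q.2 0) (fun n => q.1 (n + 1)) (fun n => q.2 (n + 1)) :=
    hF.comp (f := fun q : (ℕ → X) × (ℕ → Y) =>
      (q.1 0, q.2 0, (fun n => q.1 (n + 1)), (fun n => q.2 (n + 1)))) (by fun_prop)
  have m3 : Measurable fun q : ((X × (ℕ → X)) × Y) × (ℕ → Y) => F q.1.1.1 q.1.2 q.1.1.2 q.2 :=
    hF.comp (f := fun q : ((X × (ℕ → X)) × Y) × (ℕ → Y) => (q.1.1.1, q.1.2, q.1.1.2, q.2))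
      (by fun_prop)
  rw [lintegral_prod _ m2.aemeasurable]
  calc _ = ∫⁻ w, ∫⁻ y, ∫⁻ c, F (w 0) y (fun n => w (n + 1)) c ∂(Measure.infinitePi fun _ => μ) ∂μ
        ∂(Measure.infinitePi fun _ => ν) :=
        lintegral_congr fun w => lintegral_head_tail μ (m1 w)
    _ = ∫⁻ x, ∫⁻ w, ∫⁻ y, ∫⁻ c, F x y w c ∂(Measure.infinitePi fun _ => μ) ∂μ
        ∂(Measure.infinitePi fun _ => ν) ∂ν :=
        lintegral_head_tail ν (F := fun x w => ∫⁻ y, ∫⁻ c, F x y w c ∂_ ∂_)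
          (m3.lintegral_prod_right'.lintegral_prod_right')
    _ = _ := by
      refine lintegral_congr fun x => ?_
      have m4 : Measurable fun q : ((ℕ → X) × Y) × (ℕ → Y) => F x q.1.2 q.1.1 q.2 :=
        hF.comp (f := fun q : ((ℕ → X) × Y) × (ℕ → Y) => (x, q.1.2, q.1.1, q.2)) (by fun_prop)
      rw [lintegral_lintegral_swap m4.lintegral_prod_right'.aemeasurable]
      refine lintegral_congr fun y => ?_
      rw [lintegral_prod]
      exact (hF.comp (f := fun q : (ℕ → X) × (ℕ → Y) => (x, y, q.1, q.2))
        (by fun_prop)).aemeasurable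

end PWIT

namespace PWIT

/-! ### Thinning a Poisson process -/

theorem lintegral_expMeasure_one {F : ℝ → ℝ≥0∞} (hF : Measurable F) :
    ∫⁻ u, F u ∂(expMeasure 1) = ∫⁻ u in Ici 0, ENNReal.ofReal (Real.exp (-u)) * F u := by
  have hm : Measurable (exponentialPDF 1) := (measurable_exponentialPDFReal 1).ennreal_ofReal
  change ∫⁻ u, F u ∂(volume.withDensity (exponentialPDF 1)) = _
  rw [lintegral_withDensity_eq_lintegral_mul _ hm hF, ← lintegral_indicator measurableSet_Ici]
  refine lintegral_congr fun u => ?_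
  by_cases hu : 0 ≤ u
  · simp [indicator, hu, exponentialPDF_of_nonneg hu]
  · simp [indicator, hu, exponentialPDF_of_neg (not_le.1 hu)]

instance : IsProbabilityMeasure (expMeasure 1) := isProbabilityMeasure_expMeasure one_pos

theorem expMeasure_one_Ici {t : ℝ} (ht : 0 ≤ t) :
    expMeasure 1 (Ici t) = ENNReal.ofReal (Real.exp (-t)) := by
  rw [← lintegral_indicator_one measurableSet_Ici,
    lintegral_expMeasure_one (measurable_one.indicator measurableSet_Ici)]
  have : ∀ u, ENNReal.ofReal (Real.exp (-u)) * (Ici t).indicator 1 u =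
      (Ici t).indicator (fun u => ENNReal.ofReal (Real.exp (-u))) u := fun u => by
    by_cases h : t ≤ u <;> simp [indicator, h]
  simp_rw [this]
  rw [setLIntegral_indicator measurableSet_Ici, inter_eq_left.2 (Ici_subset_Ici.2 ht),
    setLIntegral_congr Ioi_ae_eq_Ici.symm, ← ofReal_integral_eq_lintegral_ofReal
      (integrableOn_exp_neg_Ioi t) (ae_of_all _ fun _ => (Real.exp_pos _).le), integral_exp_neg_Ioi]

theorem ae_expMeasure_one_pos : ∀ᵐ u ∂(expMeasure 1), 0 < u := by
  change expMeasure 1 {u | ¬ 0 < u} = 0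
  have hs : {u : ℝ | ¬ 0 < u} = Iic 0 := by ext; simp
  rw [hs, ← lintegral_indicator_one measurableSet_Iic,
    lintegral_expMeasure_one (measurable_one.indicator measurableSet_Iic),
    setLIntegral_congr Ioi_ae_eq_Ici.symm]
  refine (setLIntegral_congr_fun measurableSet_Ioi fun u hu => ?_).trans lintegral_zero
  simp [indicator, not_le.2 (mem_Ioi.1 hu)]

/-- The `j`-th arrival time (starting from `0`) of the process with waiting times `w`. -/
def arrival (w : ℕ → ℝ) (j : ℕ) : ℝ := ∑ i ∈ Finset.range (j + 1), w i

theorem arrival_succ (w : ℕ → ℝ) (j : ℕ) :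
    arrival w (j + 1) = w 0 + arrival (fun n => w (n + 1)) j := by
  rw [arrival, Finset.sum_range_succ', add_comm]; rfl

@[fun_prop]
theorem measurable_arrival (j : ℕ) : Measurable fun w => arrival w j := by
  unfold arrival; fun_prop

variable {D : Type*}

/-- For the arrivals after time `x` with waiting times `w` and marks `c`: exactly the first `n`
arrivals come before `y`, and exactly `k` of them are in `W`. -/
def CountIs (W : Set (D × ℝ)) (y : ℝ) : ℕ → ℕ → ℝ → (ℕ → ℝ) → (ℕ → D) → Prop
  | 0, k, x, w, _ => k = 0 ∧ y ≤ x + w 0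
  | n + 1, k, x, w, c => x + w 0 < y ∧
      (((c 0, x + w 0) ∈ W ∧ 0 < k ∧
          CountIs W y n (k - 1) (x + w 0) (fun i => w (i + 1)) (fun i => c (i + 1))) ∨
        ((c 0, x + w 0) ∉ W ∧
          CountIs W y n k (x + w 0) (fun i => w (i + 1)) (fun i => c (i + 1))))

theorem measurableSet_countIs [MeasurableSpace D] {W : Set (D × ℝ)} (hW : MeasurableSet W) (y : ℝ) (n k : ℕ) :
    MeasurableSet {p : ℝ × (ℕ → ℝ) × (ℕ → D) | CountIs W y n k p.1 p.2.1 p.2.2} := by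
  induction n generalizing k with
  | zero =>
    simp only [CountIs]
    have h1 : Measurable fun p : ℝ × (ℕ → ℝ) × (ℕ → D) => p.1 + p.2.1 0 := by fun_prop
    exact (MeasurableSet.const _).inter (h1 measurableSet_Ici)
  | succ n ih =>
    simp only [CountIs]
    have h1 : Measurable fun p : ℝ × (ℕ → ℝ) × (ℕ → D) => (p.2.2 0, p.1 + p.2.1 0) := by fun_prop
    have h2 : Measurable fun p : ℝ × (ℕ → ℝ) × (ℕ → D) =>
        (p.1 + p.2.1 0, (fun i => p.2.1 (i + 1)), fun i => p.2.2 (i + 1)) := by fun_prop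
    exact (h1.snd measurableSet_Iio).inter
      (((h1 hW).inter ((MeasurableSet.const _).inter (h2 (ih (k - 1))))).union
        ((h1 hW).compl.inter (h2 (ih k))))

/-- Makes the counting events disjoint, so that their probabilities can be added. -/
theorem CountIs.unique {W : Set (D × ℝ)} {y : ℝ} {n k n' k' : ℕ} {x : ℝ} {w : ℕ → ℝ} {c : ℕ → D}
    (h : CountIs W y n k x w c) (h' : CountIs W y n' k' x w c) : n = n' ∧ k = k' := by
  induction n generalizing k n' k' x w c with
  | zero =>
    cases n' with
    | zero => exact ⟨rfl, h.1.trans h'.1.symm⟩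
    | succ n' => exact absurd h'.1 (not_lt.2 h.2)
  | succ n ih =>
    cases n' with
    | zero => exact absurd h.1 (not_lt.2 h'.2)
    | succ n' =>
      rcases h.2 with ⟨a, b, h1⟩ | ⟨a, h1⟩ <;> rcases h'.2 with ⟨a', b', h2⟩ | ⟨a', h2⟩
      · have := ih h1 h2; omega
      · exact absurd a a'
      · exact absurd a' a
      · have := ih h1 h2; omega

theorem arrival_nonneg {w : ℕ → ℝ} (hw : ∀ i, 0 ≤ w i) (j : ℕ) : 0 ≤ arrival w j :=
  Finset.sum_nonneg fun i _ => hw i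

theorem CountIs.encard_eq {W : Set (D × ℝ)} {y : ℝ} {n k : ℕ} {x : ℝ} {w : ℕ → ℝ} {c : ℕ → D}
    (hw : ∀ i, 0 ≤ w i) (h : CountIs W y n k x w c) :
    {j | x + arrival w j < y ∧ (c j, x + arrival w j) ∈ W}.encard = k := by
  induction n generalizing k x w c with
  | zero =>
    rw [h.1, Nat.cast_zero, encard_eq_zero, eq_empty_iff_forall_notMem]
    rintro j ⟨hj, -⟩
    have := arrival_nonneg (w := fun i => w (i + 1)) (fun i => hw _)
    cases j with
    | zero => simp only [arrival, zero_add, Finset.sum_range_one] at hj; linarith [h.2]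
    | succ j => rw [arrival_succ] at hj; linarith [h.2, this j]
  | succ n ih =>
    set S := {j | x + w 0 + arrival (fun i => w (i + 1)) j < y ∧
      (c (j + 1), x + w 0 + arrival (fun i => w (i + 1)) j) ∈ W} with hS
    have hsucc : ∀ j, x + arrival w (j + 1) = x + w 0 + arrival (fun i => w (i + 1)) j := fun j => by
      rw [arrival_succ, add_assoc]
    have h0 : x + arrival w 0 = x + w 0 := by simp [arrival]
    have hinj : (Nat.succ '' S).encard = S.encard := Nat.succ_injective.encard_image S
    have hz : 0 ∉ Nat.succ '' S := by simp
    rcases h.2 with ⟨a, b, h1⟩ | ⟨a, h1⟩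
    · have hcard := ih (fun i => hw (i + 1)) h1
      have : {j | x + arrival w j < y ∧ (c j, x + arrival w j) ∈ W} = insert 0 (Nat.succ '' S) := by
        ext j
        cases j with
        | zero => simp [h0, h.1, a]
        | succ j => simp [hsucc, hS]
      rw [this, encard_insert_of_notMem hz, hinj, hcard]
      norm_cast; omega
    · have hcard := ih (fun i => hw (i + 1)) h1
      have : {j | x + arrival w j < y ∧ (c j, x + arrival w j) ∈ W} = Nat.succ '' S := by
        ext j
        cases j with
        | zero => simp [h0, a]
        | succ j => simp [hsucc, hS]
      rw [this, hinj, hcard]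

/-- The weight `H ^ k / k! * G ^ (n - k) / (n - k)!`, read as `0` if `k > n`. -/
noncomputable def splitWeight (n k : ℕ) (H G : ℝ) : ℝ :=
  if k ≤ n then H ^ k / (k.factorial : ℝ) * (G ^ (n - k) / ((n - k).factorial : ℝ)) else 0

theorem splitWeight_nonneg {n k : ℕ} {H G : ℝ} (hH : 0 ≤ H) (hG : 0 ≤ G) :
    0 ≤ splitWeight n k H G := by
  unfold splitWeight; split_ifs <;> positivity

theorem hasDerivAt_pow_succ_div_factorial {f : ℝ → ℝ} {f' x : ℝ} (hf : HasDerivAt f f' x) (k : ℕ) :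
    HasDerivAt (fun t => f t ^ (k + 1) / ((k + 1).factorial : ℝ))
      (f' * (f x ^ k / (k.factorial : ℝ))) x := by
  refine ((hf.fun_pow (k + 1)).div_const _).congr_deriv ?_
  have := k.factorial_ne_zero
  rw [Nat.factorial_succ]; push_cast; field_simp

/-- The derivative has the shape of the first-arrival decomposition: a marked arrival lowers both
`n` and `k`, an unmarked one lowers `n` only. -/
theorem hasDerivAt_splitWeight {H G : ℝ → ℝ} {H' G' x : ℝ} (hH : HasDerivAt H H' x)
    (hG : HasDerivAt G G' x) (n k : ℕ) :
    HasDerivAt (fun t => splitWeight (n + 1) k (H t) (G t))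
      (H' * (if 0 < k then splitWeight n (k - 1) (H x) (G x) else 0) +
        G' * splitWeight n k (H x) (G x)) x := by
  unfold splitWeight
  cases k with
  | zero => simpa using hasDerivAt_pow_succ_div_factorial hG n
  | succ k =>
    rcases lt_trichotomy k n with h | h | h
    · obtain ⟨m, rfl⟩ := Nat.exists_eq_add_of_lt h
      have e1 : k + m + 1 + 1 - (k + 1) = m + 1 := by omega
      have e2 : k + m + 1 - k = m + 1 := by omega
      have e3 : k + m + 1 - (k + 1) = m := by omega
      simp only [show k + 1 ≤ k + m + 1 + 1 by omega, show k + 1 ≤ k + m + 1 by omega,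
        show k ≤ k + m + 1 by omega, if_true, e1, e2, e3, Nat.add_sub_cancel, Nat.succ_pos]
      refine ((hasDerivAt_pow_succ_div_factorial hH k).mul
        (hasDerivAt_pow_succ_div_factorial hG m)).congr_deriv ?_
      ring
    · subst h
      simpa using hasDerivAt_pow_succ_div_factorial hH k
    · simp only [show ¬ k + 1 ≤ n + 1 by omega, show ¬ k + 1 ≤ n by omega,
        show ¬ k + 1 - 1 ≤ n by omega, if_false]
      simpa using hasDerivAt_const x (0 : ℝ)

end PWIT

/-! ### The joint law of the numbers of all arrivals and of marked arrivals -/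

namespace PWIT

variable {D : Type*} [MeasurableSpace D]

/-- The joint law of i.i.d. exponential waiting times and independent i.i.d. marks. -/
noncomputable def markedLaw (μ : Measure D) : Measure ((ℕ → ℝ) × (ℕ → D)) :=
  (Measure.infinitePi fun _ => expMeasure 1).prod (Measure.infinitePi fun _ => μ)

instance (μ : Measure D) [IsProbabilityMeasure μ] : IsProbabilityMeasure (markedLaw μ) := by
  unfold markedLaw; infer_instance

theorem measurableSet_countIs_prod {W : Set (D × ℝ)} (hW : MeasurableSet W) (y : ℝ) (n k : ℕ)
    (x : ℝ) : MeasurableSet {p : (ℕ → ℝ) × (ℕ → D) | CountIs W y n k x p.1 p.2} :=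
  measurable_prodMk_left (measurableSet_countIs hW y n k)

theorem measure_countIs_zero (μ : Measure D) [IsProbabilityMeasure μ] {W : Set (D × ℝ)} {x y : ℝ}
    (hxy : x ≤ y) :
    markedLaw μ {p | CountIs W y 0 0 x p.1 p.2} = ENNReal.ofReal (Real.exp (-(y - x))) := by
  have : {p : (ℕ → ℝ) × (ℕ → D) | CountIs W y 0 0 x p.1 p.2} =
      ((fun w : ℕ → ℝ => w 0) ⁻¹' Ici (y - x)) ×ˢ univ := by
    ext p; simp [CountIs, add_comm]
  rw [this, markedLaw, Measure.prod_prod, measure_univ, mul_one,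
    ← Measure.map_apply (measurable_pi_apply 0) measurableSet_Ici,
    Measure.infinitePi_map_eval (fun _ : ℕ => expMeasure 1) 0, expMeasure_one_Ici (by linarith)]

/-- Condition on the first arrival, at time `x + u`: its mark is independent of everything later,
and the process restarts from `x + u`. -/
theorem measure_countIs_succ (μ : Measure D) [IsProbabilityMeasure μ] {W : Set (D × ℝ)}
    (hW : MeasurableSet W) (y : ℝ) (n k : ℕ) (x : ℝ) :
    markedLaw μ {p | CountIs W y (n + 1) k x p.1 p.2} =
      ∫⁻ u in Ico 0 (y - x), ENNReal.ofReal (Real.exp (-u)) *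
        (μ {c | (c, x + u) ∈ W} * (if 0 < k then
            markedLaw μ {p | CountIs W y n (k - 1) (x + u) p.1 p.2} else 0) +
          μ {c | (c, x + u) ∈ W}ᶜ * markedLaw μ {p | CountIs W y n k (x + u) p.1 p.2}) := by
  set R : Set (ℝ × D × (ℕ → ℝ) × (ℕ → D)) := {q | x + q.1 < y ∧
    (((q.2.1, x + q.1) ∈ W ∧ 0 < k ∧ CountIs W y n (k - 1) (x + q.1) q.2.2.1 q.2.2.2) ∨
      ((q.2.1, x + q.1) ∉ W ∧ CountIs W y n k (x + q.1) q.2.2.1 q.2.2.2))} with hR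
  have hRm : MeasurableSet R := by
    have h0 : Measurable fun q : ℝ × D × (ℕ → ℝ) × (ℕ → D) => x + q.1 := by fun_prop
    have h1 : Measurable fun q : ℝ × D × (ℕ → ℝ) × (ℕ → D) => (q.2.1, x + q.1) := by fun_prop
    have h2 : Measurable fun q : ℝ × D × (ℕ → ℝ) × (ℕ → D) =>
        (x + q.1, q.2.2.1, q.2.2.2) := by fun_prop
    exact (h0 measurableSet_Iio).inter
      (((h1 hW).inter ((MeasurableSet.const _).inter (h2 (measurableSet_countIs hW y n (k - 1))))).union
        ((h1 hW).compl.inter (h2 (measurableSet_countIs hW y n k))))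
  have hsec : ∀ u : ℝ, MeasurableSet {c | (c, x + u) ∈ W} := fun u =>
    (measurable_prodMk_right : Measurable fun c : D => (c, x + u)) hW
  have hmeas : Measurable fun u : ℝ => μ {c | (c, x + u) ∈ W} := by
    have hm : MeasurableSet {q : ℝ × D | (q.2, x + q.1) ∈ W} :=
      (show Measurable fun q : ℝ × D => (q.2, x + q.1) by fun_prop) hW
    exact measurable_measure_prodMk_left hm
  have hcount : ∀ j, Measurable fun u : ℝ => markedLaw μ {p | CountIs W y n j (x + u) p.1 p.2} := by
    intro j
    have hm : MeasurableSet {q : ℝ × (ℕ → ℝ) × (ℕ → D) | CountIs W y n j (x + q.1) q.2.1 q.2.2} :=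
      (show Measurable fun q : ℝ × (ℕ → ℝ) × (ℕ → D) => (x + q.1, q.2.1, q.2.2) by fun_prop)
        (measurableSet_countIs hW y n j)
    exact measurable_measure_prodMk_left hm
  have hcompl : Measurable fun u : ℝ => μ {c | (c, x + u) ∈ W}ᶜ := by
    simp_rw [fun u => prob_compl_eq_one_sub (μ := μ) (hsec u)]
    exact hmeas.const_sub 1
  set f : ℝ → ℝ≥0∞ := fun u => μ {c | (c, x + u) ∈ W} * (if 0 < k then
            markedLaw μ {p | CountIs W y n (k - 1) (x + u) p.1 p.2} else 0) +
          μ {c | (c, x + u) ∈ W}ᶜ * markedLaw μ {p | CountIs W y n k (x + u) p.1 p.2} with hf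
  have hfm : Measurable f := by
    refine (hmeas.mul ?_).add (hcompl.mul (hcount k))
    split_ifs
    · exact hcount (k - 1)
    · exact measurable_const
  have step : markedLaw μ {p | CountIs W y (n + 1) k x p.1 p.2} =
      ∫⁻ u, (Iio (y - x)).indicator f u ∂(expMeasure 1) := by
    rw [← lintegral_indicator_one (measurableSet_countIs_prod hW y (n + 1) k x)]
    refine (lintegral_head_tail_prod (expMeasure 1) μ
      (F := fun u c w c' => R.indicator (1 : ℝ × D × (ℕ → ℝ) × (ℕ → D) → ℝ≥0∞) (u, c, w, c'))
      (measurable_one.indicator hRm)).trans (lintegral_congr fun u => ?_)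
    by_cases hu : u < y - x
    · have hu' : x + u < y := by linarith
      have key : ∀ c : D, ∫⁻ p, R.indicator (1 : ℝ × D × (ℕ → ℝ) × (ℕ → D) → ℝ≥0∞) (u, c, p.1, p.2) ∂(markedLaw μ) =
          {c | (c, x + u) ∈ W}.indicator (fun _ => if 0 < k then
            markedLaw μ {p | CountIs W y n (k - 1) (x + u) p.1 p.2} else 0) c +
          {c | (c, x + u) ∈ W}ᶜ.indicator (fun _ =>
            markedLaw μ {p | CountIs W y n k (x + u) p.1 p.2}) c := by
        intro c
        have e1 : ∀ p : (ℕ → ℝ) × (ℕ → D), R.indicator (1 : ℝ × D × (ℕ → ℝ) × (ℕ → D) → ℝ≥0∞) (u, c, p.1, p.2) =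
            {p : (ℕ → ℝ) × (ℕ → D) | (u, c, p.1, p.2) ∈ R}.indicator 1 p := fun p => rfl
        simp_rw [e1]
        rw [lintegral_indicator_one (show MeasurableSet {p : (ℕ → ℝ) × (ℕ → D) | (u, c, p.1, p.2) ∈ R}
          from (show Measurable fun p : (ℕ → ℝ) × (ℕ → D) => (u, c, p.1, p.2) by fun_prop) hRm)]
        by_cases hc : (c, x + u) ∈ W
        · by_cases hk : 0 < k <;> simp [hR, hc, hu', hk, indicator]
        · simp [hR, hc, hu', indicator]
      change ∫⁻ c, ∫⁻ p, R.indicator (1 : ℝ × D × (ℕ → ℝ) × (ℕ → D) → ℝ≥0∞) (u, c, p.1, p.2) ∂(markedLaw μ) ∂μ = _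
      simp_rw [key]
      rw [lintegral_add_left (measurable_const.indicator (hsec u)),
        lintegral_indicator_const (hsec u), lintegral_indicator_const (hsec u).compl,
        indicator_of_mem (show u ∈ Iio (y - x) from hu), hf]
      simp only [mul_comm]
    · have hu' : ¬ x + u < y := by linarith
      simp [hR, hu', hu, indicator]
  rw [step, lintegral_expMeasure_one (hfm.indicator measurableSet_Iio)]
  have : ∀ u, ENNReal.ofReal (Real.exp (-u)) * (Iio (y - x)).indicator f u =
      (Iio (y - x)).indicator (fun u => ENNReal.ofReal (Real.exp (-u)) * f u) u := fun u => by
    by_cases h : u < y - x <;> simp [indicator, h]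
  simp_rw [this]
  rw [setLIntegral_indicator measurableSet_Iio, inter_comm, Ici_inter_Iio]

/-- Marked and unmarked arrivals behave as independent Poisson processes of rates `h` and `1 - h`.
By induction on `n`, the integrand given by the first arrival is an exact derivative
(`hasDerivAt_splitWeight`): its exponential factors multiply to `exp (-(y - x))`, which does not
depend on `u`. -/
theorem measure_countIs (μ : Measure D) [IsProbabilityMeasure μ] {W : Set (D × ℝ)}
    (hW : MeasurableSet W) {h : ℝ → ℝ} (hc : Continuous h)
    (hh : ∀ x, 0 ≤ x → μ.real {c | (c, x) ∈ W} = h x) (y : ℝ) (n k : ℕ) {x : ℝ}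
    (hx : 0 ≤ x) (hxy : x ≤ y) :
    markedLaw μ {p | CountIs W y n k x p.1 p.2} = ENNReal.ofReal (Real.exp (-(y - x)) *
      splitWeight n k (∫ s in x..y, h s) (∫ s in x..y, (1 - h s))) := by
  have h0 : ∀ x, 0 ≤ x → 0 ≤ h x := fun x hx => hh x hx ▸ measureReal_nonneg
  have h1 : ∀ x, 0 ≤ x → h x ≤ 1 := fun x hx => hh x hx ▸ measureReal_le_one
  have hH : ∀ x, 0 ≤ x → x ≤ y → 0 ≤ ∫ s in x..y, h s := fun x hx hxy =>
    intervalIntegral.integral_nonneg hxy fun s hs => h0 s (hx.trans hs.1)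
  have hG : ∀ x, 0 ≤ x → x ≤ y → 0 ≤ ∫ s in x..y, (1 - h s) := fun x hx hxy =>
    intervalIntegral.integral_nonneg hxy fun s hs => sub_nonneg.2 (h1 s (hx.trans hs.1))
  induction n generalizing k x with
  | zero =>
    rcases Nat.eq_zero_or_pos k with rfl | hk
    · rw [measure_countIs_zero μ hxy]; simp [splitWeight]
    · have : {p : (ℕ → ℝ) × (ℕ → D) | CountIs W y 0 k x p.1 p.2} = ∅ := by
        ext p; simp [CountIs, hk.ne']
      rw [this]; simp [splitWeight, hk.ne']
  | succ n ih =>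
    rw [measure_countIs_succ μ hW]
    set r : ℝ → ℝ := fun v => h v * (if 0 < k then
        splitWeight n (k - 1) (∫ s in v..y, h s) (∫ s in v..y, (1 - h s)) else 0) +
      (1 - h v) * splitWeight n k (∫ s in v..y, h s) (∫ s in v..y, (1 - h s)) with hr
    have hr0 : ∀ v, 0 ≤ v → v ≤ y → 0 ≤ r v := by
      intro v hv hvy
      have a := h0 v hv
      have b := sub_nonneg.2 (h1 v hv)
      have c := fun j => splitWeight_nonneg (n := n) (k := j) (hH v hv hvy) (hG v hv hvy)
      refine add_nonneg (mul_nonneg a ?_) (mul_nonneg b (c k))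
      split_ifs
      exacts [c _, le_rfl]
    have hdH : ∀ v, HasDerivAt (fun v => ∫ s in v..y, h s) (-h v) v := fun v =>
      intervalIntegral.integral_hasDerivAt_left (hc.intervalIntegrable _ _)
        (hc.stronglyMeasurableAtFilter _ _) hc.continuousAt
    have hc' : Continuous fun s => 1 - h s := by fun_prop
    have hdG : ∀ v, HasDerivAt (fun v => ∫ s in v..y, (1 - h s)) (-(1 - h v)) v := fun v =>
      intervalIntegral.integral_hasDerivAt_left (hc'.intervalIntegrable _ _)
        (hc'.stronglyMeasurableAtFilter _ _) hc'.continuousAt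
    have hHc : Continuous fun v => ∫ s in v..y, h s :=
      continuous_iff_continuousAt.2 fun v => (hdH v).continuousAt
    have hGc : Continuous fun v => ∫ s in v..y, (1 - h s) :=
      continuous_iff_continuousAt.2 fun v => (hdG v).continuousAt
    have hSc : ∀ j, Continuous fun v =>
        splitWeight n j (∫ s in v..y, h s) (∫ s in v..y, (1 - h s)) := by
      intro j
      unfold splitWeight
      split_ifs <;> fun_prop
    have hrc : Continuous r := by
      refine (hc.mul ?_).add (hc'.mul (hSc k))
      split_ifs
      exacts [hSc _, continuous_const]
    have e : ∀ u ∈ Ico 0 (y - x), ENNReal.ofReal (Real.exp (-u)) *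
        (μ {c | (c, x + u) ∈ W} * (if 0 < k then
            markedLaw μ {p | CountIs W y n (k - 1) (x + u) p.1 p.2} else 0) +
          μ {c | (c, x + u) ∈ W}ᶜ * markedLaw μ {p | CountIs W y n k (x + u) p.1 p.2}) =
        ENNReal.ofReal (Real.exp (-(y - x)) * r (x + u)) := by
      rintro u ⟨hu0, hu1⟩
      have a : 0 ≤ x + u := by linarith
      have b : x + u ≤ y := by linarith
      have m1 : μ {c | (c, x + u) ∈ W} = ENNReal.ofReal (h (x + u)) := by
        rw [← hh _ a, measureReal_def, ENNReal.ofReal_toReal (measure_ne_top _ _)]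
      have m2 : μ {c | (c, x + u) ∈ W}ᶜ = ENNReal.ofReal (1 - h (x + u)) := by
        rw [prob_compl_eq_one_sub (show MeasurableSet {c | (c, x + u) ∈ W} from
          (measurable_prodMk_right : Measurable fun c : D => (c, x + u)) hW),
          m1, ENNReal.ofReal_sub _ (h0 _ a), ENNReal.ofReal_one]
      have m3 : (if 0 < k then markedLaw μ {p | CountIs W y n (k - 1) (x + u) p.1 p.2} else 0) =
          ENNReal.ofReal (Real.exp (-(y - (x + u))) * if 0 < k then
            splitWeight n (k - 1) (∫ s in (x + u)..y, h s) (∫ s in (x + u)..y, (1 - h s)) else 0) := by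
        split_ifs
        · exact ih _ a b
        · simp
      have n3 : 0 ≤ if 0 < k then
            splitWeight n (k - 1) (∫ s in (x + u)..y, h s) (∫ s in (x + u)..y, (1 - h s)) else 0 := by
        split_ifs
        · exact splitWeight_nonneg (hH _ a b) (hG _ a b)
        · exact le_rfl
      have n4 := splitWeight_nonneg (n := n) (k := k) (hH _ a b) (hG _ a b)
      have n5 := sub_nonneg.2 (h1 _ a)
      rw [m3, ih k a b, m1, m2, ← ENNReal.ofReal_mul (h0 _ a), ← ENNReal.ofReal_mul n5,
        ← ENNReal.ofReal_add (mul_nonneg (h0 _ a) (mul_nonneg (Real.exp_pos _).le n3))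
          (mul_nonneg n5 (mul_nonneg (Real.exp_pos _).le n4)),
        ← ENNReal.ofReal_mul (Real.exp_pos _).le]
      congr 1
      have : Real.exp (-(y - x)) = Real.exp (-u) * Real.exp (-(y - (x + u))) := by
        rw [← Real.exp_add]; ring_nf
      rw [this, hr]
      ring
    have hyx : 0 ≤ y - x := by linarith
    have hint : Continuous fun u => Real.exp (-(y - x)) * r (x + u) := by fun_prop
    rw [setLIntegral_congr_fun measurableSet_Ico e,
      setLIntegral_congr (Ico_ae_eq_Ioc (μ := volume) (a := 0) (b := y - x)),
      ← ofReal_integral_eq_lintegral_ofReal, ← intervalIntegral.integral_of_le hyx]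
    · congr 1
      have hd : ∀ u ∈ uIcc 0 (y - x), HasDerivAt (fun u => -(Real.exp (-(y - x)) *
          splitWeight (n + 1) k (∫ s in (x + u)..y, h s) (∫ s in (x + u)..y, (1 - h s))))
          (Real.exp (-(y - x)) * r (x + u)) u := by
        intro u _
        have hw := ((hasDerivAt_splitWeight (hdH (x + u)) (hdG (x + u)) n k).comp_const_add x u)
        refine (hw.const_mul (Real.exp (-(y - x)))).neg.congr_deriv ?_
        rw [hr]; ring
      rw [intervalIntegral.integral_eq_sub_of_hasDerivAt hd (hint.intervalIntegrable _ _)]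
      -- The boundary term at `u = y - x`: both integrals are over an empty interval, and at least
      -- one exponent is positive since the exponents sum to `n + 1`.
      have hz : splitWeight (n + 1) k 0 0 = 0 := by
        unfold splitWeight
        split_ifs with hk
        · rcases Nat.eq_zero_or_pos k with rfl | hk0
          · simp
          · simp [hk0.ne']
        · rfl
      simp [hz]
    · exact (hint.integrableOn_Icc (a := 0) (b := y - x)).mono_set Ioc_subset_Icc_self
    · refine (ae_restrict_iff' measurableSet_Ioc).2 (ae_of_all _ fun u hu => ?_)
      exact mul_nonneg (Real.exp_pos _).le (hr0 _ (by linarith [hu.1]) (by linarith [hu.2]))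

end PWIT

/-! ### The Poisson law of the number of marked arrivals -/

namespace PWIT

variable {D : Type*} [MeasurableSpace D]

theorem hasSum_splitWeight (k : ℕ) (H G : ℝ) :
    HasSum (fun n => splitWeight n k H G) (H ^ k / (k.factorial : ℝ) * Real.exp G) := by
  have h1 : HasSum (fun m => splitWeight (m + k) k H G)
      (H ^ k / (k.factorial : ℝ) * Real.exp G) := by
    have : ∀ m, splitWeight (m + k) k H G =
        H ^ k / (k.factorial : ℝ) * (G ^ m / (m.factorial : ℝ)) := fun m => by
      simp [splitWeight]
    simp_rw [this]
    have := (NormedSpace.expSeries_div_hasSum_exp G).mul_left (H ^ k / (k.factorial : ℝ))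
    rwa [← Real.exp_eq_exp_ℝ] at this
  have h2 := (hasSum_nat_add_iff (f := fun n => splitWeight n k H G) k).1 h1
  have h3 : ∑ n ∈ Finset.range k, splitWeight n k H G = 0 :=
    Finset.sum_eq_zero fun n hn => if_neg (not_le.2 (Finset.mem_range.1 hn))
  rwa [h3, add_zero] at h2

section Poisson

variable (μ : Measure D) [IsProbabilityMeasure μ] {W : Set (D × ℝ)} (hW : MeasurableSet W)
  {h : ℝ → ℝ} (hc : Continuous h) (hh : ∀ x, 0 ≤ x → μ.real {c | (c, x) ∈ W} = h x)
  {y : ℝ} (hy : 0 ≤ y)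
include hW hc hh hy

theorem measure_iUnion_countIs (k : ℕ) :
    markedLaw μ (⋃ n, {p | CountIs W y n k 0 p.1 p.2}) = ENNReal.ofReal
      (Real.exp (-∫ s in 0..y, h s) * ((∫ s in 0..y, h s) ^ k / (k.factorial : ℝ))) := by
  have h0 : ∀ x, 0 ≤ x → 0 ≤ h x := fun x hx => hh x hx ▸ measureReal_nonneg
  have h1 : ∀ x, 0 ≤ x → h x ≤ 1 := fun x hx => hh x hx ▸ measureReal_le_one
  rw [measure_iUnion]
  · simp_rw [fun n => measure_countIs μ hW hc hh y n k le_rfl hy]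
    have hs := (hasSum_splitWeight k (∫ s in 0..y, h s) (∫ s in 0..y, (1 - h s))).mul_left
      (Real.exp (-(y - 0)))
    rw [← ENNReal.ofReal_tsum_of_nonneg _ hs.summable, hs.tsum_eq]
    · congr 1
      -- The two means add up to `y`, so summing out the unmarked arrivals leaves only `exp (-∫ h)`
      -- of the factor `exp (-y)`.
      have hi : (∫ s in 0..y, (1 - h s)) = y - ∫ s in 0..y, h s := by
        rw [intervalIntegral.integral_sub (continuous_const.intervalIntegrable _ _)
          (hc.intervalIntegrable _ _)]
        simp
      have he : Real.exp (-∫ s in 0..y, h s) =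
          Real.exp (-(y - 0)) * Real.exp (y - ∫ s in 0..y, h s) := by
        rw [← Real.exp_add]; ring_nf
      rw [he, hi]; ring
    · intro n
      exact mul_nonneg (Real.exp_pos _).le (splitWeight_nonneg
        (intervalIntegral.integral_nonneg hy fun s hs => h0 s hs.1)
        (intervalIntegral.integral_nonneg hy fun s hs => sub_nonneg.2 (h1 s hs.1)))
  · intro n m hnm
    exact Set.disjoint_left.2 fun p hp hp' => hnm (CountIs.unique hp hp').1
  · exact fun n => measurableSet_countIs_prod hW y n k 0

/-- The Poisson weights sum to `1`, so almost surely only finitely many arrivals precede `y`. -/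
theorem ae_exists_countIs : ∀ᵐ p ∂(markedLaw μ), ∃ k n, CountIs W y n k 0 p.1 p.2 := by
  have hm : MeasurableSet (⋃ k, ⋃ n, {p : (ℕ → ℝ) × (ℕ → D) | CountIs W y n k 0 p.1 p.2}) :=
    .iUnion fun k => .iUnion fun n => measurableSet_countIs_prod hW y n k 0
  have : markedLaw μ (⋃ k, ⋃ n, {p | CountIs W y n k 0 p.1 p.2}) = 1 := by
    rw [measure_iUnion]
    · simp_rw [measure_iUnion_countIs μ hW hc hh hy]
      have hs := ((NormedSpace.expSeries_div_hasSum_exp (∫ s in 0..y, h s)).mul_left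
        (Real.exp (-∫ s in 0..y, h s)))
      rw [← Real.exp_eq_exp_ℝ, ← Real.exp_add, neg_add_cancel, Real.exp_zero] at hs
      rw [← ENNReal.ofReal_tsum_of_nonneg _ hs.summable, hs.tsum_eq, ENNReal.ofReal_one]
      intro k
      have : 0 ≤ ∫ s in 0..y, h s := intervalIntegral.integral_nonneg hy fun s hs =>
        hh s hs.1 ▸ measureReal_nonneg
      positivity
    · intro k l hkl
      simp only [Function.onFun, disjoint_iUnion_left, disjoint_iUnion_right]
      exact fun n m => Set.disjoint_left.2 fun p hp hp' => hkl (CountIs.unique hp' hp).2.symm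
    · exact fun k => .iUnion fun n => measurableSet_countIs_prod hW y n k 0
  have h2 := (prob_compl_eq_zero_iff hm).2 this
  filter_upwards [compl_mem_ae_iff.2 h2] with p hp
  simpa using hp

omit hW hc hh hy in
theorem ae_waiting_pos : ∀ᵐ w ∂(Measure.infinitePi fun _ : ℕ => expMeasure 1), ∀ i, 0 < w i := by
  refine ae_all_iff.2 fun i => ?_
  have := ae_expMeasure_one_pos
  rw [← Measure.infinitePi_map_eval (fun _ : ℕ => expMeasure 1) i] at this
  exact ae_of_ae_map (measurable_pi_apply i).aemeasurable this

omit hW hc hh hy [IsProbabilityMeasure μ] in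
theorem ae_markedLaw_waiting_pos : ∀ᵐ p ∂(markedLaw μ), ∀ i, 0 < p.1 i :=
  Measure.quasiMeasurePreserving_fst.ae ae_waiting_pos

/-- The number of arrivals before `y` with mark in `W` has Poisson distribution with mean
`∫ s in 0..y, h s`, where `h s` is the probability that an arrival at time `s` is in `W`. -/
theorem measure_encard_lt (d : ℕ) :
    markedLaw μ {p | {j | arrival p.1 j < y ∧ (p.2 j, arrival p.1 j) ∈ W}.encard < d} =
      ENNReal.ofReal (∑ k ∈ Finset.range d, Real.exp (-∫ s in 0..y, h s) *
        ((∫ s in 0..y, h s) ^ k / (k.factorial : ℝ))) := by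
  have hae : {p : (ℕ → ℝ) × (ℕ → D) |
      {j | arrival p.1 j < y ∧ (p.2 j, arrival p.1 j) ∈ W}.encard < d} =ᵐ[markedLaw μ]
      ⋃ k ∈ Finset.range d, ⋃ n, {p | CountIs W y n k 0 p.1 p.2} := by
    filter_upwards [ae_exists_countIs μ hW hc hh hy, ae_markedLaw_waiting_pos μ] with p hp hpos
    obtain ⟨k, n, hk⟩ := hp
    have he := hk.encard_eq fun i => (hpos i).le
    simp only [zero_add] at he
    refine propext ?_
    change {j | arrival p.1 j < y ∧ (p.2 j, arrival p.1 j) ∈ W}.encard < d ↔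
      p ∈ ⋃ k ∈ Finset.range d, ⋃ n, {p : (ℕ → ℝ) × (ℕ → D) | CountIs W y n k 0 p.1 p.2}
    rw [he]
    simp only [mem_iUnion, Set.mem_ofPred_eq, Finset.mem_range, Nat.cast_lt, exists_prop]
    exact ⟨fun h => ⟨k, h, n, hk⟩, fun ⟨k', h, n', hk'⟩ => (hk.unique hk').2 ▸ h⟩
  rw [measure_congr hae, measure_biUnion_finset]
  · simp_rw [measure_iUnion_countIs μ hW hc hh hy]
    rw [ENNReal.ofReal_sum_of_nonneg]
    intro k _
    have : 0 ≤ ∫ s in 0..y, h s := intervalIntegral.integral_nonneg hy fun s hs =>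
        hh s hs.1 ▸ measureReal_nonneg
    positivity
  · intro k _ l _ hkl
    simp only [Function.onFun, disjoint_iUnion_left, disjoint_iUnion_right]
    exact fun n m => Set.disjoint_left.2 fun p hp hp' => hkl (CountIs.unique hp' hp).2.symm
  · exact fun k _ => .iUnion fun n => measurableSet_countIs_prod hW y n k 0

end Poisson

end PWIT

namespace PWIT

/-! ### The process on a fixed decorated tree -/

/-- A decorated tree: each vertex carries its degree constraint and the waiting times between the
labels of the edges to its children. -/
abbrev TreeData := Vertex → ℕ × (ℕ → ℝ)

/-- The decorated subtree of the descendants of `v`, re-rooted at `v`. -/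
def subtree (a : TreeData) (v : Vertex) : TreeData := fun u => a (v ++ u)

/-- The labels of the edges of a decorated tree. -/
def label (a : TreeData) (e : Edge) : ℝ := arrival (a e.1).2 e.2

/-- The degree constraints of a decorated tree. -/
def constraint (a : TreeData) (v : Vertex) : ℕ := (a v).1

/-- The root is not saturated right before time `y` in the process run on the descendants of the
root up to generation `n`. -/
def Unsat : ℕ → TreeData → ℝ → Prop
  | 0, _, _ => True
  | n + 1, a, y => {k | arrival (a []).2 k < y ∧
      Unsat n (subtree a [k]) (arrival (a []).2 k)}.encard < (a []).1

/-- There is a path of `n` edges going down from the root with decreasing labels less than `y`. -/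
def DecPath : ℕ → TreeData → ℝ → Prop
  | 0, _, _ => True
  | n + 1, a, y => ∃ k, arrival (a []).2 k < y ∧ DecPath n (subtree a [k]) (arrival (a []).2 k)

/-- The deterministic conditions under which the process is well defined. -/
structure IsGood (a : TreeData) : Prop where
  pos : ∀ v j, 0 < (a v).2 j
  no_path : ∀ v (m : ℕ), ∃ n, ¬ DecPath n (subtree a v) m

theorem subtree_subtree (a : TreeData) (v : Vertex) (k : ℕ) :
    subtree (subtree a v) [k] = subtree a (v ++ [k]) := by
  funext u; simp [subtree]

theorem subtree_apply_nil (a : TreeData) (v : Vertex) : subtree a v [] = a v := by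
  simp [subtree]

theorem DecPath.mono {n : ℕ} {a : TreeData} {y y' : ℝ} (h : DecPath n a y) (hy : y ≤ y') :
    DecPath n a y' := by
  cases n with
  | zero => trivial
  | succ n => exact let ⟨k, hk, h'⟩ := h; ⟨k, hk.trans_le hy, h'⟩

theorem DecPath.of_succ {n : ℕ} {a : TreeData} {y : ℝ} (h : DecPath (n + 1) a y) :
    DecPath n a y := by
  induction n generalizing a y with
  | zero => trivial
  | succ n ih => exact let ⟨k, hk, h'⟩ := h; ⟨k, hk, ih h'⟩

theorem DecPath.anti {n m : ℕ} (hnm : n ≤ m) {a : TreeData} {y : ℝ} (h : DecPath m a y) :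
    DecPath n a y := by
  induction m, hnm using Nat.le_induction with
  | base => exact h
  | succ m _ ih => exact ih h.of_succ

theorem strictMono_arrival {w : ℕ → ℝ} (hw : ∀ i, 0 < w i) : StrictMono (arrival w) :=
  strictMono_nat_of_lt_succ fun n => by
    rw [arrival, arrival, Finset.sum_range_succ _ (n + 1)]; linarith [hw (n + 1)]

theorem IsGood.strictMono {a : TreeData} (h : IsGood a) (v : Vertex) :
    StrictMono fun j => label a (v, j) := strictMono_arrival (h.pos v)

theorem IsGood.label_pos {a : TreeData} (h : IsGood a) (e : Edge) : 0 < label a e := by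
  unfold label arrival
  exact Finset.sum_pos (fun i _ => h.pos _ i) ⟨0, by simp⟩

theorem IsGood.exists_not_decPath {a : TreeData} (h : IsGood a) (v : Vertex) (y : ℝ) :
    ∃ n, ¬ DecPath n (subtree a v) y :=
  let ⟨m, hm⟩ := exists_nat_ge y
  let ⟨n, hn⟩ := h.no_path v m
  ⟨n, fun h' => hn (h'.mono hm)⟩

/-! ### Existence and uniqueness of the process -/

/-- `e'` shares an endpoint with `e`, has a smaller label, and descends from `v`. -/
def EarlierAdj (X : Edge → ℝ) (v : Vertex) (e' e : Edge) : Prop :=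
  (∃ u, Incident u e' ∧ Incident u e) ∧ X e' < X e ∧ v <+: e'.1

/-- An earlier neighbour of an edge below `v ++ [j]` is again below it or is the edge `(v, j)`
itself. The alternatives in `hX` make the latter impossible, because labels only decrease, or
harmless. -/
theorem acc_earlierAdj_of_child {X : Edge → ℝ} {v : Vertex} {j : ℕ} {e : Edge}
    (h : Acc (EarlierAdj X (v ++ [j])) e) (he : v ++ [j] <+: e.1)
    (hX : X e ≤ X (v, j) ∨ Acc (EarlierAdj X v) (v, j)) : Acc (EarlierAdj X v) e := by
  induction h with
  | intro e _ ih =>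
    refine Acc.intro _ fun e' ⟨⟨u, hu', hu⟩, hlt, hv⟩ => ?_
    have hpre : v ++ [j] <+: u := by
      rcases hu with rfl | rfl
      · exact he
      · exact he.trans (List.prefix_append _ _)
    have hcase : v ++ [j] <+: e'.1 ∨ e' = (v, j) := by
      rcases hu' with rfl | rfl
      · exact Or.inl hpre
      · rcases List.prefix_concat_iff.1 hpre with h | h
        · obtain ⟨h1, h2⟩ := List.append_inj' h rfl
          exact Or.inr (Prod.ext h1.symm (List.singleton_inj.1 h2).symm)
        · exact Or.inl h
    rcases hcase with h | rfl
    · exact ih e' ⟨⟨u, hu', hu⟩, hlt, h⟩ h (hX.imp_left hlt.le.trans)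
    · exact hX.elim (fun h => absurd hlt (not_lt.2 h)) id

/-- Outer induction on depth, inner induction on siblings. An earlier sibling of `(v, j)` has a
smaller index. An earlier edge just below `(v, j)` starts a decreasing descent, and the child has no
decreasing path of one edge less, since `(v, j)` could be prepended to it. -/
theorem acc_earlierAdj_of_not_decPath {a : TreeData} (ha : IsGood a) {n : ℕ} {v : Vertex} {y : ℝ}
    (h : ¬ DecPath n (subtree a v) y) (j : ℕ) (hj : label a (v, j) < y) :
    Acc (EarlierAdj (label a) v) (v, j) := by
  induction n generalizing v y j with
  | zero => exact absurd trivial h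
  | succ n ih =>
    induction j using Nat.strong_induction_on with
    | _ j ihj =>
      refine Acc.intro _ fun e' ⟨⟨u, hu', hu⟩, hlt, hv⟩ => ?_
      rcases hu with rfl | rfl
      · rcases hu' with rfl | hu'
        · exact ihj e'.2 ((ha.strictMono e'.1).lt_iff_lt.1 hlt) (hlt.trans hj)
        · have := hv.length_le
          have hl := congrArg List.length hu'
          simp at this hl
          omega
      · rcases hu' with hu' | hu'
        · have hn : ¬ DecPath n (subtree a (v ++ [j])) (label a (v, j)) := fun hd =>
            h ⟨j, by rwa [subtree_apply_nil], by
              rw [subtree_subtree, subtree_apply_nil]; exact hd⟩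
          have he' : e' = (v ++ [j], e'.2) := Prod.ext hu'.symm rfl
          rw [he'] at hlt ⊢
          exact acc_earlierAdj_of_child (ih hn e'.2 hlt) List.prefix_rfl (Or.inl hlt.le)
        · obtain ⟨h1, h2⟩ := List.append_inj' hu' rfl
          have : e' = (v, j) := Prod.ext h1.symm (List.singleton_inj.1 h2).symm
          exact absurd hlt (this ▸ lt_irrefl _)

theorem IsGood.acc_earlierAdj {a : TreeData} (ha : IsGood a) (v : Vertex) (j : ℕ) :
    Acc (EarlierAdj (label a) v) (v, j) :=
  let ⟨_, hn⟩ := ha.exists_not_decPath v (label a (v, j) + 1)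
  acc_earlierAdj_of_not_decPath ha hn j (lt_add_one _)

theorem IsGood.acc_earlierAdj_nil {a : TreeData} (ha : IsGood a) (v : Vertex) {e : Edge}
    (he : v <+: e.1) (h : Acc (EarlierAdj (label a) v) e) :
    Acc (EarlierAdj (label a) []) e := by
  induction v using List.reverseRecOn with
  | nil => exact h
  | append_singleton v j ih =>
    exact ih ((List.prefix_append _ _).trans he)
      (acc_earlierAdj_of_child h he (Or.inr (ha.acc_earlierAdj v j)))

theorem IsGood.wellFounded {a : TreeData} (ha : IsGood a) :
    WellFounded (EarlierAdj (label a) []) :=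
  ⟨fun e => ha.acc_earlierAdj_nil e.1 List.prefix_rfl (ha.acc_earlierAdj e.1 e.2)⟩

/-- Whether `e` is added depends only on earlier edges sharing an endpoint with it, so well-founded
recursion constructs `E` and well-founded induction proves it unique. -/
theorem existsUnique_isRDCP {X : Edge → ℝ} (hX : WellFounded (EarlierAdj X [])) (d : Vertex → ℕ) :
    ∃! E, IsRDCP X d E := by
  let F : ∀ e : Edge, (∀ e', EarlierAdj X [] e' e → Prop) → Prop := fun e ih =>
    ∀ v, Incident v e → {e' | ∃ h : EarlierAdj X [] e' e, Incident v e' ∧ ih e' h}.encard < d v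
  refine ⟨{e | hX.fix F e}, fun e => ?_, fun E hE => ?_⟩
  · change hX.fix F e ↔ _
    rw [hX.fix_eq]
    refine forall₂_congr fun v hv => ?_
    rw [degreeBefore]
    suffices {e' | ∃ _ : EarlierAdj X [] e' e, Incident v e' ∧ hX.fix F e'} =
        {e' | e' ∈ {e | hX.fix F e} ∧ Incident v e' ∧ X e' < X e} by rw [this]
    ext e'
    exact ⟨fun ⟨h, hv', h'⟩ => ⟨h', hv', h.2.1⟩,
      fun ⟨h', hv', h⟩ => ⟨⟨⟨v, hv', hv⟩, h, List.nil_prefix⟩, hv', h'⟩⟩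
  · ext e
    change e ∈ E ↔ hX.fix F e
    induction e using hX.induction with
    | _ e ih =>
      rw [hE e, hX.fix_eq]
      refine forall₂_congr fun v hv => ?_
      rw [degreeBefore]
      suffices {e' | e' ∈ E ∧ Incident v e' ∧ X e' < X e} =
          {e' | ∃ _ : EarlierAdj X [] e' e, Incident v e' ∧ hX.fix F e'} by rw [this]
      ext e'
      exact ⟨fun ⟨h', hv', h⟩ =>
          have hr : EarlierAdj X [] e' e := ⟨⟨v, hv', hv⟩, h, List.nil_prefix⟩
          ⟨hr, hv', (ih e' hr).1 h'⟩,
        fun ⟨h, hv', h'⟩ => ⟨(ih e' h).2 h', hv', h.2.1⟩⟩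

/-! ### The saturation time of the root -/

/-- Here `V` is the set of willing children and `F` the set accepted one by one up to capacity `d`.
As long as `F` is not full nobody has been refused, so `F = V`. This replaces the actual degree of a
vertex by a count over independent subtrees. -/
theorem encard_lt_iff_of_greedy {d : ℕ} {F V : Set ℕ}
    (h : ∀ k, k ∈ F ↔ k ∈ V ∧ {k' | k' ∈ F ∧ k' < k}.encard < d) :
    F.encard < d ↔ V.encard < d := by
  refine ⟨fun hF => ?_, fun hV => (encard_le_encard fun k hk => ((h k).1 hk).1).trans_lt hV⟩
  have : F = V := by
    ext k
    rw [h k]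
    exact and_iff_left ((encard_le_encard fun _ hk => hk.1).trans_lt hF)
  rwa [← this]

/-- Among `d + 1` accepted indices the largest would have been accepted after `d` others. Hence a
degree never overshoots the constraint, and saturation is an equality. -/
theorem encard_le_of_greedy {d : ℕ} {F : Set ℕ}
    (h : ∀ k ∈ F, {k' | k' ∈ F ∧ k' < k}.encard < d) : F.encard ≤ d := by
  by_contra! hlt
  obtain ⟨t, htF, ht⟩ := exists_subset_encard_eq (Order.add_one_le_of_lt hlt)
  have hfin : t.Finite := finite_of_encard_eq_coe (k := d + 1) (by exact_mod_cast ht)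
  have hne : t.Nonempty := by
    rw [← encard_ne_zero, ht]; exact_mod_cast d.succ_ne_zero
  obtain ⟨k, hk, hmax⟩ := hfin.exists_maximalFor id t hne
  have hmax' : ∀ k' ∈ t, k' ≤ k := fun k' hk' => by
    by_contra! hc; exact absurd (hmax hk' hc.le) (not_le.2 hc)
  have h1 := encard_sdiff_singleton_add_one hk
  rw [ht] at h1
  have h2 : (t \ {k}).encard = d := by
    exact ENat.add_left_injective_of_ne_top ENat.one_ne_top (by simpa using h1)
  have h3 : t \ {k} ⊆ {k' | k' ∈ F ∧ k' < k} := fun k' hk' =>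
    ⟨htF hk'.1, lt_of_le_of_ne (hmax' k' hk'.1) hk'.2⟩
  exact absurd (h k (htF hk)) (not_lt.2 (h2 ▸ encard_le_encard h3))

theorem degreeBefore_eq {X : Edge → ℝ} (E : Set Edge) {v : Vertex} {y : ℝ}
    (hy : ∀ u j, v = u ++ [j] → y ≤ X (u, j)) :
    degreeBefore X E v y = {k | X (v, k) < y ∧ (v, k) ∈ E}.encard := by
  have hinj : Function.Injective fun k : ℕ => ((v, k) : Edge) := fun _ _ h => (Prod.ext_iff.1 h).2
  rw [← hinj.encard_image, degreeBefore]
  congr 1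
  ext e
  constructor
  · rintro ⟨he, hv | hv, hlt⟩
    · exact ⟨e.2, by subst hv; exact ⟨hlt, he⟩, by rw [hv]⟩
    · exact absurd hlt (not_lt.2 (hy _ _ hv))
  · rintro ⟨k, ⟨hlt, he⟩, rfl⟩
    exact ⟨he, Or.inl rfl, hlt⟩

theorem forall_incident {Q : Vertex → Prop} {e : Edge} :
    (∀ v, Incident v e → Q v) ↔ Q e.1 ∧ Q (e.1 ++ [e.2]) := by
  simp [Incident, or_imp, forall_and]

theorem degreeBefore_label_eq {a : TreeData} (ha : IsGood a) (E : Set Edge) {v : Vertex} {k : ℕ}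
    (hy : ∀ u j, v = u ++ [j] → label a (v, k) ≤ label a (u, j)) :
    degreeBefore (label a) E v (label a (v, k)) = {k' | (v, k') ∈ E ∧ k' < k}.encard := by
  rw [degreeBefore_eq E hy]
  simp only [(ha.strictMono v).lt_iff_lt, and_comm]

/-- The hypothesis `hy` keeps the parent edge of `v` out of play before `y`, so only descendants
matter. A child `k` is treated at time `label a (v, k)`, exactly when its own parent edge rings, so
the same hypothesis holds for it. -/
theorem unsat_iff {a : TreeData} (ha : IsGood a) {E : Set Edge}
    (hE : IsRDCP (label a) (constraint a) E) {n : ℕ} {v : Vertex} {y : ℝ}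
    (hn : ¬ DecPath n (subtree a v) y) (hy : ∀ u j, v = u ++ [j] → y ≤ label a (u, j)) :
    Unsat n (subtree a v) y ↔ degreeBefore (label a) E v y < constraint a v := by
  induction n generalizing v y with
  | zero => exact absurd trivial hn
  | succ n ih =>
    rw [degreeBefore_eq E hy]
    simp only [Unsat, subtree_apply_nil, subtree_subtree]
    refine (encard_lt_iff_of_greedy fun k => ?_).symm
    change label a (v, k) < y ∧ _ ↔ (label a (v, k) < y ∧ Unsat n _ (label a (v, k))) ∧ _
    rw [and_assoc]
    refine and_congr_right fun hk => ?_
    have hchild : ¬ DecPath n (subtree a (v ++ [k])) (label a (v, k)) := fun hd =>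
      hn ⟨k, by rwa [subtree_apply_nil], by rw [subtree_subtree, subtree_apply_nil]; exact hd⟩
    rw [hE, forall_incident, ih hchild, and_comm, degreeBefore_label_eq ha E fun u j huj =>
      hk.le.trans (hy u j huj)]
    · refine and_congr_right fun _ => ?_
      suffices {k' | (v, k') ∈ E ∧ k' < k} =
          {k' | k' ∈ {k | label a (v, k) < y ∧ (v, k) ∈ E} ∧ k' < k} by
        simp only [this]; rfl
      ext k'
      exact ⟨fun h => ⟨⟨((ha.strictMono v) h.2).trans hk, h.1⟩, h.2⟩, fun h => ⟨h.1.2, h.2⟩⟩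
    · intro u j huj
      obtain ⟨h1, h2⟩ := List.append_inj' huj rfl
      rw [h1, List.singleton_inj.1 h2]

theorem phantomSaturationTime_lt_iff {a : TreeData} (ha : IsGood a) (hd : 0 < constraint a [])
    {E : Set Edge} (hE : IsRDCP (label a) (constraint a) E) (y : ℝ≥0) :
    phantomSaturationTime (label a) (constraint a) [] < y ↔
      ¬ degreeBefore (label a) E [] y < constraint a [] := by
  have hr : rdcpEdges (label a) (constraint a) = E :=
    rdcpEdges_eq (existsUnique_isRDCP ha.wellFounded _) hE
  have hroot : ∀ k, ((([] : Vertex), k) ∈ E) →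
      {k' | (([] : Vertex), k') ∈ E ∧ k' < k}.encard < constraint a [] := fun k hk => by
    rw [← degreeBefore_label_eq ha E (by simp)]
    exact (forall_incident.1 ((hE _).1 hk)).1
  change sInf {s : ℝ≥0∞ | ∃ t : ℝ≥0, s = t ∧
    degreeAt (label a) (rdcpEdges (label a) (constraint a)) [] t = constraint a []} < y ↔ _
  rw [hr, not_lt, sInf_lt_iff]
  constructor
  · rintro ⟨_, ⟨t, rfl, ht⟩, hty⟩
    rw [← ht]
    refine encard_le_encard fun e he => ⟨he.1, he.2.1, he.2.2.trans_lt ?_⟩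
    exact_mod_cast hty
  · intro h
    rw [degreeBefore_eq E (by simp)] at h
    -- Choose exactly `constraint a []` root edges added before `y`. The largest of their labels is
    -- a time at which the degree equals the constraint.
    obtain ⟨t, hts, ht⟩ := exists_subset_encard_eq h
    have hfin : t.Finite := finite_of_encard_eq_coe ht
    have hne : t.Nonempty := by
      rw [← encard_ne_zero, ht]; exact_mod_cast hd.ne'
    obtain ⟨k, hk, hmax⟩ := hfin.exists_maximalFor id t hne
    have hmax' : ∀ k' ∈ t, k' ≤ k := fun k' hk' => by
      by_contra! hc; exact absurd (hmax hk' hc.le) (not_le.2 hc)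
    obtain ⟨s, hs⟩ : ∃ s : ℝ≥0, (s : ℝ) = label a ([], k) := ⟨⟨_, (ha.label_pos ([], k)).le⟩, rfl⟩
    refine ⟨_, ⟨s, rfl, le_antisymm ?_ ?_⟩, ?_⟩
    · have hinj : Function.Injective fun k : ℕ => (([], k) : Edge) :=
        fun _ _ h => (Prod.ext_iff.1 h).2
      refine le_trans ?_ (encard_le_of_greedy (F := {k | (([] : Vertex), k) ∈ E}) hroot)
      rw [← hinj.encard_image]
      refine encard_le_encard ?_
      rintro e ⟨he, hv | hv, -⟩
      · exact ⟨e.2, show ([], e.2) ∈ E by rwa [hv], by simp [hv]⟩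
      · simp at hv
    · have hinj : Function.Injective fun k : ℕ => (([], k) : Edge) :=
        fun _ _ h => (Prod.ext_iff.1 h).2
      rw [← ht, ← hinj.encard_image]
      refine encard_le_encard ?_
      rintro _ ⟨k', hk', rfl⟩
      exact ⟨(hts hk').2, Or.inl rfl, 
        hs ▸ (ha.strictMono []).monotone (hmax' k' hk')⟩
    · rw [ENNReal.coe_lt_coe, ← NNReal.coe_lt_coe, hs]
      exact (hts hk).1

end PWIT

namespace PWIT

/-! ### The law of the decorated tree -/

/-- The law of the constraint and the waiting times of one vertex. -/
noncomputable def nodeLaw (π : Measure ℕ) : Measure (ℕ × (ℕ → ℝ)) :=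
  π.prod (Measure.infinitePi fun _ => expMeasure 1)

instance (π : Measure ℕ) [IsProbabilityMeasure π] : IsProbabilityMeasure (nodeLaw π) := by
  unfold nodeLaw; infer_instance

/-- The law of the decorated tree. -/
noncomputable def treeLaw (π : Measure ℕ) : Measure TreeData :=
  Measure.infinitePi fun _ => nodeLaw π

instance (π : Measure ℕ) [IsProbabilityMeasure π] : IsProbabilityMeasure (treeLaw π) := by
  unfold treeLaw; infer_instance

@[fun_prop]
theorem measurable_subtree (v : Vertex) : Measurable fun a => subtree a v :=
  measurable_pi_lambda _ fun u => measurable_pi_apply (v ++ u)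

theorem measurePreserving_subtree (π : Measure ℕ) [IsProbabilityMeasure π] (v : Vertex) :
    MeasurePreserving (fun a => subtree a v) (treeLaw π) (treeLaw π) :=
  ⟨measurable_subtree v, Measure.map_infinitePi_infinitePi_of_inj (P := fun _ : Vertex => nodeLaw π)
    (List.append_right_injective v)⟩

/-- Turns the child subtrees into i.i.d. marks on the root's labels, so that the thinning results
apply with `TreeData` as the space of marks. -/
theorem measurePreserving_root_subtrees (π : Measure ℕ) [IsProbabilityMeasure π] :
    MeasurePreserving (fun a : TreeData => ((a []).1, (a []).2, fun k => subtree a [k]))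
      (treeLaw π) (π.prod (markedLaw (treeLaw π))) := by
  have h1 : MeasurePreserving (fun a : TreeData => (a [], fun p : ℕ × Vertex => a (p.1 :: p.2)))
      (treeLaw π) ((nodeLaw π).prod (Measure.infinitePi fun _ => nodeLaw π)) :=
    ⟨by fun_prop, map_infinitePi_eval_prod_comp (nodeLaw π)
      (f := fun p : ℕ × Vertex => p.1 :: p.2)
      (fun p q h => Prod.ext (List.cons.inj h).1 (List.cons.inj h).2) (by simp)⟩
  have h2 : MeasurePreserving (MeasurableEquiv.curry ℕ Vertex (ℕ × (ℕ → ℝ)))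
      (Measure.infinitePi fun _ => nodeLaw π) (Measure.infinitePi fun _ => treeLaw π) :=
    ⟨by fun_prop, Measure.infinitePi_map_curry fun _ _ => nodeLaw π⟩
  have h3 := (measurePreserving_prodAssoc π (Measure.infinitePi fun _ : ℕ => expMeasure 1)
    (Measure.infinitePi fun _ : ℕ => treeLaw π)).comp
      (((MeasurePreserving.id (nodeLaw π)).prod h2).comp h1)
  exact h3

/-- The complement says that some finite set of `f a` indices is realised, a countable union over
finite sets. -/
theorem measurableSet_encard_lt {α : Type*} [MeasurableSpace α] {R : ℕ → Set α}
    (hR : ∀ j, MeasurableSet (R j)) {f : α → ℕ} (hf : Measurable f) :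
    MeasurableSet {a | {j | a ∈ R j}.encard < f a} := by
  have : {a | {j | a ∈ R j}.encard < f a} =
      (⋃ t : Finset ℕ, {a | f a = t.card} ∩ ⋂ j ∈ t, R j)ᶜ := by
    ext a
    simp only [Set.mem_ofPred_eq, mem_compl_iff, mem_iUnion, mem_inter_iff, mem_iInter, not_exists]
    rw [← not_le, not_iff_comm, not_forall]
    simp only [not_not]
    constructor
    · rintro ⟨t, ht, hts⟩
      rw [ht, ← encard_coe_eq_coe_finsetCard]
      exact encard_le_encard fun j hj => hts j hj
    · intro h
      obtain ⟨t, hts, ht⟩ := exists_subset_encard_eq h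
      have hfin : t.Finite := finite_of_encard_eq_coe ht
      refine ⟨hfin.toFinset, ?_, fun j hj => hts (hfin.mem_toFinset.1 hj)⟩
      rw [hfin.encard_eq_coe_toFinset_card] at ht
      exact_mod_cast ht.symm
  rw [this]
  exact (MeasurableSet.iUnion fun t => (hf (measurableSet_singleton _)).inter
    (Finset.measurableSet_biInter _ fun j _ => hR j)).compl

theorem measurableSet_unsat (n : ℕ) :
    MeasurableSet {q : TreeData × ℝ | Unsat n q.1 q.2} := by
  induction n with
  | zero => simp [Unsat]
  | succ n ih =>
    refine measurableSet_encard_lt (R := fun k => {q : TreeData × ℝ | arrival (q.1 []).2 k < q.2 ∧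
      Unsat n (subtree q.1 [k]) (arrival (q.1 []).2 k)}) (fun k => ?_) (f := fun q => (q.1 []).1)
      (by fun_prop)
    have h1 : Measurable fun q : TreeData × ℝ => arrival (q.1 []).2 k := by fun_prop
    have h2 : Measurable fun q : TreeData × ℝ => (subtree q.1 [k], arrival (q.1 []).2 k) := by
      fun_prop
    exact (measurableSet_lt h1 measurable_snd).inter (h2 ih)

theorem measurableSet_decPath (n : ℕ) :
    MeasurableSet {q : TreeData × ℝ | DecPath n q.1 q.2} := by
  induction n with
  | zero => simp [DecPath]
  | succ n ih =>
    simp only [DecPath, Set.ofPred_exists]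
    refine .iUnion fun k => ?_
    have h1 : Measurable fun q : TreeData × ℝ => arrival (q.1 []).2 k := by fun_prop
    have h2 : Measurable fun q : TreeData × ℝ => (subtree q.1 [k], arrival (q.1 []).2 k) := by
      fun_prop
    exact (measurableSet_lt h1 measurable_snd).inter (h2 ih)

/-! ### Conditioning on the root's constraint and its children's subtrees -/

section Recursion

variable (π : Measure ℕ) [IsProbabilityMeasure π] {W : Set (TreeData × ℝ)} (hW : MeasurableSet W)
  {h : ℝ → ℝ} (hc : Continuous h) (hh : ∀ x, 0 ≤ x → (treeLaw π).real {a | (a, x) ∈ W} = h x)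
  {y : ℝ} (hy : 0 ≤ y)
include hW hc hh hy

theorem measure_root_encard_lt :
    treeLaw π {a | {k | arrival (a []).2 k < y ∧
        (subtree a [k], arrival (a []).2 k) ∈ W}.encard < (a []).1} =
      ∑' d : ℕ, ENNReal.ofReal (∑ k ∈ Finset.range d, Real.exp (-∫ s in 0..y, h s) *
        ((∫ s in 0..y, h s) ^ k / (k.factorial : ℝ))) * π {d} := by
  have hm : MeasurableSet {q : ℕ × (ℕ → ℝ) × (ℕ → TreeData) |
      {k | arrival q.2.1 k < y ∧ (q.2.2 k, arrival q.2.1 k) ∈ W}.encard < q.1} := by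
    refine measurableSet_encard_lt (R := fun k => {q : ℕ × (ℕ → ℝ) × (ℕ → TreeData) |
      arrival q.2.1 k < y ∧ (q.2.2 k, arrival q.2.1 k) ∈ W}) (fun k => ?_) measurable_fst
    have h1 : Measurable fun q : ℕ × (ℕ → ℝ) × (ℕ → TreeData) => arrival q.2.1 k := by fun_prop
    have h2 : Measurable fun q : ℕ × (ℕ → ℝ) × (ℕ → TreeData) => (q.2.2 k, arrival q.2.1 k) := by
      fun_prop
    exact (h1 measurableSet_Iio).inter (h2 hW)
  refine ((measurePreserving_root_subtrees π).measure_preimage hm.nullMeasurableSet).trans ?_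
  rw [Measure.prod_apply hm, lintegral_countable']
  exact tsum_congr fun d => by rw [← measure_encard_lt (treeLaw π) hW hc hh hy]; rfl

/-- The zero term of the Poisson law, i.e. a count below `1`; it gives the recursion for decreasing
paths, where the constraint plays no role. -/
theorem measure_root_no_mark :
    treeLaw π {a | ¬ ∃ k, arrival (a []).2 k < y ∧ (subtree a [k], arrival (a []).2 k) ∈ W} =
      ENNReal.ofReal (Real.exp (-∫ s in 0..y, h s)) := by
  have hm : MeasurableSet {q : ℕ × (ℕ → ℝ) × (ℕ → TreeData) |
      {k | arrival q.2.1 k < y ∧ (q.2.2 k, arrival q.2.1 k) ∈ W}.encard < (1 : ℕ)} := by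
    refine measurableSet_encard_lt (R := fun k => {q : ℕ × (ℕ → ℝ) × (ℕ → TreeData) |
      arrival q.2.1 k < y ∧ (q.2.2 k, arrival q.2.1 k) ∈ W}) (fun k => ?_) measurable_const
    have h1 : Measurable fun q : ℕ × (ℕ → ℝ) × (ℕ → TreeData) => arrival q.2.1 k := by fun_prop
    have h2 : Measurable fun q : ℕ × (ℕ → ℝ) × (ℕ → TreeData) => (q.2.2 k, arrival q.2.1 k) := by
      fun_prop
    exact (h1 measurableSet_Iio).inter (h2 hW)
  have he : {a : TreeData | ¬ ∃ k, arrival (a []).2 k < y ∧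
      (subtree a [k], arrival (a []).2 k) ∈ W} =
      (fun a : TreeData => ((a []).1, (a []).2, fun k => subtree a [k])) ⁻¹'
        {q : ℕ × (ℕ → ℝ) × (ℕ → TreeData) |
      {k | arrival q.2.1 k < y ∧ (q.2.2 k, arrival q.2.1 k) ∈ W}.encard < (1 : ℕ)} := by
    ext a
    simp [eq_empty_iff_forall_notMem]
  rw [he, (measurePreserving_root_subtrees π).measure_preimage hm.nullMeasurableSet,
    Measure.prod_apply hm]
  have : ∀ d : ℕ, markedLaw (treeLaw π) (Prod.mk d ⁻¹' {q : ℕ × (ℕ → ℝ) × (ℕ → TreeData) |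
      {k | arrival q.2.1 k < y ∧ (q.2.2 k, arrival q.2.1 k) ∈ W}.encard < (1 : ℕ)}) =
      ENNReal.ofReal (Real.exp (-∫ s in 0..y, h s)) := fun d => by
    refine (measure_encard_lt (treeLaw π) hW hc hh hy 1).trans ?_
    simp
  simp_rw [this]
  rw [lintegral_const, measure_univ, mul_one]

end Recursion

/-! ### Decreasing paths -/

/-- The probability that there is a decreasing path of length `n` with labels less than `y`. -/
noncomputable def pathProb : ℕ → ℝ → ℝ
  | 0, _ => 1
  | n + 1, y => 1 - Real.exp (-∫ s in 0..y, pathProb n s)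

theorem continuous_pathProb (n : ℕ) : Continuous (pathProb n) := by
  induction n with
  | zero => exact continuous_const
  | succ n ih =>
    have := intervalIntegral.continuous_primitive (μ := volume) (fun a b => ih.intervalIntegrable a b) 0
    simp only [pathProb]; fun_prop

theorem measureReal_decPath (π : Measure ℕ) [IsProbabilityMeasure π] (n : ℕ) {y : ℝ} (hy : 0 ≤ y) :
    (treeLaw π).real {a | DecPath n a y} = pathProb n y := by
  induction n generalizing y with
  | zero => simp [DecPath, pathProb]
  | succ n ih =>
    have h := measure_root_no_mark π (measurableSet_decPath n) (continuous_pathProb n)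
      (fun x hx => ih hx) hy
    have hm : MeasurableSet {a | DecPath (n + 1) a y} :=
      (measurable_prodMk_right : Measurable fun a : TreeData => (a, y)) (measurableSet_decPath (n + 1))
    have h' : (treeLaw π).real {a | DecPath (n + 1) a y}ᶜ =
        Real.exp (-∫ s in 0..y, pathProb n s) := by
      rw [← ENNReal.toReal_ofReal (Real.exp_pos (-∫ s in 0..y, pathProb n s)).le, ← h]; rfl
    rw [probReal_compl_eq_one_sub hm] at h'
    simp only [pathProb]; linarith

/-- Iterate `1 - exp (-x) ≤ x` inside the integral. -/
theorem pathProb_le (π : Measure ℕ) [IsProbabilityMeasure π] (n : ℕ) {y : ℝ} (hy : 0 ≤ y) :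
    pathProb n y ≤ y ^ n / (n.factorial : ℝ) := by
  induction n generalizing y with
  | zero => simp [pathProb]
  | succ n ih =>
    have hi : ∫ s in 0..y, pathProb n s ≤ ∫ s in 0..y, s ^ n / (n.factorial : ℝ) :=
      intervalIntegral.integral_mono_on hy ((continuous_pathProb n).intervalIntegrable _ _)
        (Continuous.intervalIntegrable (by fun_prop) _ _) fun s hs => ih hs.1
    have he : ∫ s in 0..y, s ^ n / (n.factorial : ℝ) = y ^ (n + 1) / ((n + 1).factorial : ℝ) := by
      have := n.factorial_ne_zero
      rw [intervalIntegral.integral_div, integral_pow, Nat.factorial_succ]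
      push_cast; field_simp; simp
    have := Real.add_one_le_exp (-∫ s in 0..y, pathProb n s)
    simp only [pathProb]; linarith

theorem ae_exists_not_decPath (π : Measure ℕ) [IsProbabilityMeasure π] :
    ∀ᵐ a ∂(treeLaw π), ∀ m : ℕ, ∃ n, ¬ DecPath n a m := by
  refine ae_all_iff.2 fun m => ?_
  have hm : (0 : ℝ) ≤ m := m.cast_nonneg
  change treeLaw π {a | ¬ ∃ n, ¬ DecPath n a m} = 0
  rw [← measureReal_eq_zero_iff]
  refine le_antisymm (ge_of_tendsto' (FloorSemiring.tendsto_pow_div_factorial_atTop (m : ℝ))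
    fun n => ?_) measureReal_nonneg
  refine le_trans ?_ (pathProb_le π n hm)
  rw [← measureReal_decPath π n hm]
  refine measureReal_mono fun a ha => ?_
  simp only [Set.mem_ofPred_eq, not_exists, not_not] at ha
  exact ha n

theorem ae_isGood (π : Measure ℕ) [IsProbabilityMeasure π] : ∀ᵐ a ∂(treeLaw π), IsGood a := by
  have hv : ∀ v : Vertex, MeasurePreserving (fun a : TreeData => (a v).2) (treeLaw π)
      (Measure.infinitePi fun _ => expMeasure 1) := fun v =>
    measurePreserving_snd.comp (measurePreserving_eval_infinitePi (fun _ : Vertex => nodeLaw π) v)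
  have h1 : ∀ᵐ a ∂(treeLaw π), ∀ v j, 0 < (a v).2 j :=
    ae_all_iff.2 fun v => (hv v).quasiMeasurePreserving.ae ae_waiting_pos
  have h2 : ∀ᵐ a ∂(treeLaw π), ∀ v, ∀ m : ℕ, ∃ n, ¬ DecPath n (subtree a v) m :=
    ae_all_iff.2 fun v =>
      (measurePreserving_subtree π v).quasiMeasurePreserving.ae (ae_exists_not_decPath π)
  filter_upwards [h1, h2] with a a1 a2 using ⟨a1, a2⟩

end PWIT

namespace PWIT

open Filter Topology

/-! ### The right-hand side of the initial value problem -/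

/-- The right-hand side `exp (-x) * ∑_{k < Δ} x ^ k / k! * q (k + 1)`. -/
noncomputable def rate (p : ℕ → ℝ) (Δ : ℕ) (x : ℝ) : ℝ :=
  Real.exp (-x) * ∑ k ∈ Finset.range Δ, x ^ k / (k.factorial : ℝ) * q p (k + 1)

theorem contDiff_rate (p : ℕ → ℝ) (Δ : ℕ) {n : WithTop ℕ∞} : ContDiff ℝ n (rate p Δ) := by
  unfold rate; fun_prop

theorem continuous_rate (p : ℕ → ℝ) (Δ : ℕ) : Continuous (rate p Δ) :=
  (contDiff_rate p Δ (n := 0)).continuous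

theorem tendsto_rate_atTop (p : ℕ → ℝ) (Δ : ℕ) : Tendsto (rate p Δ) atTop (𝓝 0) := by
  have : rate p Δ = fun x => ∑ k ∈ Finset.range Δ,
      (x ^ k * Real.exp (-x)) * (q p (k + 1) / (k.factorial : ℝ)) := by
    funext x
    rw [rate, Finset.mul_sum]
    exact Finset.sum_congr rfl fun k _ => by ring
  rw [this]
  have h : ∀ k ∈ Finset.range Δ, Tendsto (fun x : ℝ =>
      (x ^ k * Real.exp (-x)) * (q p (k + 1) / (k.factorial : ℝ))) atTop (𝓝 0) := fun k _ => by
    simpa using (Real.tendsto_pow_mul_exp_neg_atTop_nhds_zero k).mul_const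
      (q p (k + 1) / (k.factorial : ℝ))
  simpa using tendsto_finsetSum _ h

theorem hasDerivAt_sum_pow_div_factorial (c : ℕ → ℝ) (M : ℕ) (x : ℝ) :
    HasDerivAt (fun x => ∑ k ∈ Finset.range (M + 1), x ^ k / (k.factorial : ℝ) * c k)
      (∑ k ∈ Finset.range M, x ^ k / (k.factorial : ℝ) * c (k + 1)) x := by
  induction M with
  | zero => simpa using hasDerivAt_const x (c 0)
  | succ M ih =>
    simp only [Finset.sum_range_succ _ (M + 1)]
    rw [Finset.sum_range_succ]
    refine ih.add (((hasDerivAt_pow_succ_div_factorial (hasDerivAt_id x) M).mul_const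
      (c (M + 1))).congr_deriv (by simp))

section DegreeDistribution

variable {p : ℕ → ℝ} {Δ : ℕ} (hp : IsDegreeDistribution p Δ)
include hp

theorem IsDegreeDistribution.one_lt : 1 < Δ := by
  by_contra! h
  have : p = 0 := funext fun k => by
    rcases lt_or_ge k 2 with hk | hk
    · exact hp.lower k hk
    · exact hp.upper k (by omega)
  have h1 := hp.sum_eq_one
  rw [this] at h1
  exact zero_ne_one (hasSum_zero.unique h1)

theorem IsDegreeDistribution.summable_shift (k : ℕ) : Summable fun l => p (k + l) := by
  simpa [add_comm] using (summable_nat_add_iff k).2 hp.sum_eq_one.summable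

theorem IsDegreeDistribution.q_nonneg (k : ℕ) : 0 ≤ q p k := tsum_nonneg fun _ => hp.nonneg _

theorem IsDegreeDistribution.q_eq_add (k : ℕ) : q p k = p k + q p (k + 1) := by
  rw [q, (hp.summable_shift k).tsum_eq_zero_add]
  simp only [q, add_zero, add_assoc, add_comm 1]

theorem IsDegreeDistribution.q_one : q p 1 = 1 := by
  have h := hp.q_eq_add 0
  rw [hp.lower 0 (by norm_num), q] at h
  simpa [hp.sum_eq_one.tsum_eq] using h.symm

theorem IsDegreeDistribution.q_of_lt {k : ℕ} (hk : Δ < k) : q p k = 0 := by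
  simp [q, fun l => hp.upper (k + l) (by omega)]

theorem IsDegreeDistribution.q_succ_eq_sum (k : ℕ) :
    q p (k + 1) = ∑ d ∈ Finset.range (Δ + 1), if k < d then p d else 0 := by
  have h0 : ∀ d ∉ Finset.range (Δ + 1), (if k < d then p d else 0) = 0 := fun d hd => by
    rw [hp.upper d (by simpa using hd), ite_self]
  have hs : Summable fun d => if k < d then p d else 0 := summable_of_ne_finset_zero h0
  have he : ∑' d, (if k < d then p d else 0) = ∑ d ∈ Finset.range (Δ + 1), if k < d then p d else 0 :=
    tsum_eq_sum h0
  rw [← he, ← hs.sum_add_tsum_nat_add (k + 1), Finset.sum_eq_zero, zero_add, q]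
  · refine tsum_congr fun l => ?_
    rw [if_pos (by omega), add_comm]
  · intro d hd
    rw [if_neg (by have := Finset.mem_range.1 hd; omega)]

theorem IsDegreeDistribution.tsum_p_succ (x : ℝ) :
    ∑' k : ℕ, x ^ k / (k.factorial : ℝ) * p (k + 1) =
      ∑ k ∈ Finset.range Δ, x ^ k / (k.factorial : ℝ) * p (k + 1) :=
  tsum_eq_sum fun k hk => by
    rw [hp.upper (k + 1) (by have := Finset.mem_range.not.1 hk; omega), mul_zero]

theorem IsDegreeDistribution.rate_pos {x : ℝ} (hx : 0 ≤ x) : 0 < rate p Δ x := by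
  refine mul_pos (Real.exp_pos _) (Finset.sum_pos' (fun k _ => ?_)
    ⟨0, Finset.mem_range.2 (zero_lt_one.trans hp.one_lt), by simp [hp.q_one]⟩)
  exact mul_nonneg (by positivity) (hp.q_nonneg _)

theorem IsDegreeDistribution.hasDerivAt_rate (x : ℝ) : HasDerivAt (rate p Δ)
    (-(Real.exp (-x) * ∑' k : ℕ, x ^ k / (k.factorial : ℝ) * p (k + 1))) x := by
  obtain ⟨M, rfl⟩ : ∃ M, Δ = M + 1 := ⟨Δ - 1, by have := hp.one_lt; omega⟩
  have h1 : HasDerivAt (fun x : ℝ => Real.exp (-x)) (Real.exp (-x) * -1) x :=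
    (hasDerivAt_neg x).exp
  have h2 := hasDerivAt_sum_pow_div_factorial (fun k => q p (k + 1)) M x
  refine (h1.mul h2).congr_deriv ?_
  -- The added term contains `q p (Δ + 1) = 0`; with equal ranges the difference of the sums
  -- telescopes `q` to `p`.
  have h3 : ∑ k ∈ Finset.range M, x ^ k / (k.factorial : ℝ) * q p (k + 1 + 1) =
      ∑ k ∈ Finset.range (M + 1), x ^ k / (k.factorial : ℝ) * q p (k + 1 + 1) := by
    rw [Finset.sum_range_succ, hp.q_of_lt (by omega), mul_zero, add_zero]
  have h4 : ∑ k ∈ Finset.range (M + 1), x ^ k / (k.factorial : ℝ) * q p (k + 1) =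
      ∑ k ∈ Finset.range (M + 1), x ^ k / (k.factorial : ℝ) * p (k + 1) +
      ∑ k ∈ Finset.range (M + 1), x ^ k / (k.factorial : ℝ) * q p (k + 1 + 1) := by
    rw [← Finset.sum_add_distrib]
    exact Finset.sum_congr rfl fun k _ => by rw [hp.q_eq_add (k + 1)]; ring
  rw [hp.tsum_p_succ, h3, h4]
  ring

/-- The probability that a Poisson variable of mean `H` is below the random constraint: exchanging
the sums over `d` and `k` collects `∑ p d` over `d > k`, which is `q p (k + 1)`. -/
theorem IsDegreeDistribution.tsum_eq_rate {H : ℝ} (hH : 0 ≤ H) :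
    ∑' d : ℕ, ENNReal.ofReal (∑ k ∈ Finset.range d, Real.exp (-H) *
        (H ^ k / (k.factorial : ℝ))) * ENNReal.ofReal (p d) = ENNReal.ofReal (rate p Δ H) := by
  have hnn : ∀ k : ℕ, 0 ≤ Real.exp (-H) * (H ^ k / (k.factorial : ℝ)) := fun k => by positivity
  rw [tsum_eq_sum (s := Finset.range (Δ + 1)) fun d hd => by
    rw [hp.upper d (by simpa using hd), ENNReal.ofReal_zero, mul_zero]]
  simp_rw [← ENNReal.ofReal_mul (Finset.sum_nonneg fun k (_ : k ∈ Finset.range _) => hnn k)]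
  rw [← ENNReal.ofReal_sum_of_nonneg fun d _ =>
    mul_nonneg (Finset.sum_nonneg fun k _ => hnn k) (hp.nonneg d), rate, Finset.mul_sum]
  congr 1
  simp_rw [hp.q_succ_eq_sum, Finset.mul_sum, Finset.sum_mul]
  rw [Finset.sum_comm (s := Finset.range Δ)]
  refine Finset.sum_congr rfl fun d hd => ?_
  have hsub : Finset.range d ⊆ Finset.range Δ :=
    Finset.range_subset_range.2 (Nat.lt_succ_iff.1 (Finset.mem_range.1 hd))
  rw [← Finset.sum_subset hsub fun k _ hk => by
    rw [if_neg (by simpa using hk)]; simp]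
  refine Finset.sum_congr rfl fun k hk => ?_
  rw [if_pos (Finset.mem_range.1 hk)]; ring

end DegreeDistribution

/-! ### The initial value problem -/

/-- On `[0, T]` both solutions stay in one compact ball, where the smooth function `rate` is
Lipschitz. -/
theorem SolvesIVP.eqOn {p : ℕ → ℝ} {Δ : ℕ} {lam mu : ℝ → ℝ} (hl : SolvesIVP p Δ lam)
    (hm : SolvesIVP p Δ mu) : EqOn mu lam (Ici 0) := by
  intro T hT
  have hcl : ContinuousOn lam (Ici 0) := fun t ht => (hl.2 t ht).continuousWithinAt
  have hcm : ContinuousOn mu (Ici 0) := fun t ht => (hm.2 t ht).continuousWithinAt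
  have hsub : Icc 0 T ⊆ Ici 0 := Icc_subset_Ici_self
  obtain ⟨R₁, hR₁⟩ := isCompact_Icc.exists_bound_of_continuousOn (hcl.mono hsub)
  obtain ⟨R₂, hR₂⟩ := isCompact_Icc.exists_bound_of_continuousOn (hcm.mono hsub)
  obtain ⟨K, hK⟩ := (contDiff_rate p Δ (n := 1)).contDiffOn.exists_lipschitzOnWith one_ne_zero
    (convex_closedBall (0 : ℝ) (max R₁ R₂)) (isCompact_closedBall _ _)
  refine ODE_solution_unique_of_mem_Icc_right (v := fun _ => rate p Δ)
    (s := fun _ => Metric.closedBall 0 (max R₁ R₂)) (fun _ _ => hK) (hcm.mono hsub) ?_ ?_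
    (hcl.mono hsub) ?_ ?_ (hm.1.trans hl.1.symm) (right_mem_Icc.2 hT)
  · exact fun t ht => (hm.2 t ht.1).mono (Ici_subset_Ici.2 ht.1)
  · exact fun t ht => mem_closedBall_zero_iff.2
      ((hR₂ t (Ico_subset_Icc_self ht)).trans (le_max_right _ _))
  · exact fun t ht => (hl.2 t ht.1).mono (Ici_subset_Ici.2 ht.1)
  · exact fun t ht => mem_closedBall_zero_iff.2
      ((hR₁ t (Ico_subset_Icc_self ht)).trans (le_max_left _ _))

/-- Solutions on `[0, ∞)` of the integrated initial value problem. -/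
structure SolvesIntegral (p : ℕ → ℝ) (Δ : ℕ) (lam : ℝ → ℝ) : Prop where
  continuous : Continuous lam
  nonneg : ∀ t, 0 ≤ t → 0 ≤ lam t
  hasDerivAt : ∀ t, 0 ≤ t → HasDerivAt lam (rate p Δ (lam t)) t
  eq_integral : ∀ t, 0 ≤ t → lam t = ∫ s in 0..t, rate p Δ (lam s)

/-! ### Growth of the solution and integrals of its derivatives -/

section SolvesIntegral

variable {p : ℕ → ℝ} {Δ : ℕ} {lam : ℝ → ℝ} (hl : SolvesIntegral p Δ lam)
include hl

theorem SolvesIntegral.solvesIVP : SolvesIVP p Δ lam :=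
  ⟨by rw [hl.eq_integral 0 le_rfl, intervalIntegral.integral_same],
    fun t ht => (hl.hasDerivAt t ht).hasDerivWithinAt⟩

theorem SolvesIntegral.derivWithin {t : ℝ} (ht : 0 ≤ t) :
    derivWithin lam (Ici 0) t = rate p Δ (lam t) :=
  (hl.hasDerivAt t ht).hasDerivWithinAt.derivWithin (uniqueDiffOn_Ici 0 t ht)

theorem SolvesIntegral.continuous_rate_comp : Continuous fun s => rate p Δ (lam s) :=
  (continuous_rate p Δ).comp hl.continuous

variable (hp : IsDegreeDistribution p Δ)
include hp

theorem SolvesIntegral.monotoneOn : MonotoneOn lam (Ici 0) := by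
  refine monotoneOn_of_deriv_nonneg (convex_Ici 0) hl.continuous.continuousOn ?_ ?_
  · intro t ht
    rw [interior_Ici] at ht
    exact (hl.hasDerivAt t (le_of_lt ht)).differentiableAt.differentiableWithinAt
  · intro t ht
    rw [interior_Ici] at ht
    rw [(hl.hasDerivAt t (le_of_lt ht)).deriv]
    exact (hp.rate_pos (hl.nonneg t (le_of_lt ht))).le

/-- If `lam` stayed below `L`, its slope would be at least the minimum `m > 0` of `rate` on `[0,
L]`, forcing `lam (L / m + 1) ≥ L + m`. -/
theorem SolvesIntegral.exists_lt (L : ℝ) : ∃ t, 0 ≤ t ∧ L < lam t := by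
  by_contra! hb
  have hL : 0 ≤ L := (hl.nonneg 0 le_rfl).trans (hb 0 le_rfl)
  obtain ⟨x, hx, hmin⟩ := isCompact_Icc.exists_isMinOn (nonempty_Icc.2 hL)
    (continuous_rate p Δ).continuousOn
  have hm := hp.rate_pos hx.1
  set m := rate p Δ x
  have ht : (0 : ℝ) ≤ L / m + 1 := by positivity
  have h1 : ∫ _ in 0..(L / m + 1), m ≤ ∫ s in 0..(L / m + 1), rate p Δ (lam s) :=
    intervalIntegral.integral_mono_on ht (continuous_const.intervalIntegrable _ _)
      (hl.continuous_rate_comp.intervalIntegrable _ _)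
      fun s hs => hmin ⟨hl.nonneg s hs.1, hb s hs.1⟩
  rw [← hl.eq_integral _ ht, intervalIntegral.integral_const, sub_zero, smul_eq_mul, add_mul,
    div_mul_cancel₀ _ hm.ne', one_mul] at h1
  linarith [hb _ ht]

theorem SolvesIntegral.tendsto_atTop : Tendsto lam atTop atTop := by
  refine Filter.tendsto_atTop.2 fun L => ?_
  obtain ⟨t, ht, hL⟩ := hl.exists_lt hp L
  filter_upwards [eventually_ge_atTop t] with s hs
  exact hL.le.trans (hl.monotoneOn hp ht (ht.trans hs) hs)

theorem SolvesIntegral.tendsto_rate : Tendsto (fun t => rate p Δ (lam t)) atTop (𝓝 0) :=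
  (tendsto_rate_atTop p Δ).comp (hl.tendsto_atTop hp)

theorem SolvesIntegral.lintegral_rate_eq_top :
    ∫⁻ t in Ioi 0, ENNReal.ofReal (rate p Δ (lam t)) = ⊤ := by
  refine ENNReal.eq_top_of_forall_nnreal_le fun r => ?_
  obtain ⟨t, ht, hL⟩ := hl.exists_lt hp r
  calc (r : ℝ≥0∞) ≤ ENNReal.ofReal (lam t) := by
        rw [← ENNReal.ofReal_coe_nnreal]; exact ENNReal.ofReal_le_ofReal hL.le
    _ = ∫⁻ s in Ioc 0 t, ENNReal.ofReal (rate p Δ (lam s)) := by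
        rw [hl.eq_integral t ht, intervalIntegral.integral_of_le ht,
          ofReal_integral_eq_lintegral_ofReal]
        · exact (hl.continuous_rate_comp.integrableOn_Icc (a := 0) (b := t)).mono_set
            Ioc_subset_Icc_self
        · refine (ae_restrict_iff' measurableSet_Ioc).2 (ae_of_all _ fun s hs => ?_)
          exact (hp.rate_pos (hl.nonneg s hs.1.le)).le
    _ ≤ _ := lintegral_mono_set Ioc_subset_Ioi_self

/-- The density `-lam''`. -/
theorem SolvesIntegral.hasDerivAt_rate_comp {t : ℝ} (ht : 0 ≤ t) :
    HasDerivAt (fun s => rate p Δ (lam s)) (-(rate p Δ (lam t) * Real.exp (-lam t) *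
      ∑' k : ℕ, lam t ^ k / (k.factorial : ℝ) * p (k + 1))) t := by
  refine ((hp.hasDerivAt_rate (lam t)).comp t (hl.hasDerivAt t ht)).congr_deriv ?_
  ring

/-- The integrand is `-lam''` and `lam'` tends to `0`, so the integral from `t` is `lam' t`. -/
theorem SolvesIntegral.lintegral_density {t : ℝ} (ht : 0 ≤ t) :
    ∫⁻ s in Ici t, ENNReal.ofReal (rate p Δ (lam s) * Real.exp (-lam s) *
      ∑' k : ℕ, lam s ^ k / (k.factorial : ℝ) * p (k + 1)) = ENNReal.ofReal (rate p Δ (lam t)) := by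
  set f : ℝ → ℝ := fun s => rate p Δ (lam s) * Real.exp (-lam s) *
      ∑' k : ℕ, lam s ^ k / (k.factorial : ℝ) * p (k + 1) with hf
  have hnn : ∀ s, 0 ≤ s → 0 ≤ f s := fun s hs => by
    have h0 := hl.nonneg s hs
    exact mul_nonneg (mul_nonneg (hp.rate_pos h0).le (Real.exp_pos _).le)
      (tsum_nonneg fun k => mul_nonneg (by positivity) (hp.nonneg _))
  have hd : ∀ s ∈ Ici t, HasDerivAt (fun s => rate p Δ (lam s)) (-f s) s := fun s hs =>
    hl.hasDerivAt_rate_comp hp (ht.trans hs)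
  have hneg : ∀ s ∈ Ioi t, -f s ≤ 0 := fun s hs => neg_nonpos.2 (hnn s (ht.trans (le_of_lt hs)))
  have hi := integrableOn_Ioi_deriv_of_nonpos' hd hneg (hl.tendsto_rate hp)
  have he := integral_Ioi_of_hasDerivAt_of_nonpos' hd hneg (hl.tendsto_rate hp)
  rw [integral_neg, zero_sub, neg_inj] at he
  rw [setLIntegral_congr Ioi_ae_eq_Ici.symm, ← he, ofReal_integral_eq_lintegral_ofReal]
  · have := hi.neg
    simp only [Pi.neg_def, neg_neg] at this
    exact this
  · exact (ae_restrict_iff' measurableSet_Ioi).2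
      (ae_of_all _ fun s hs => hnn s (ht.trans (le_of_lt hs)))

end SolvesIntegral

end PWIT

namespace PWIT

open Filter Topology

/-! ### The probability that the root is not saturated -/

/-- The probability that the root is not saturated before `y` in the process run up to
generation `n`. -/
noncomputable def unsatProb (p : ℕ → ℝ) (Δ : ℕ) : ℕ → ℝ → ℝ
  | 0, _ => 1
  | n + 1, y => rate p Δ (∫ s in 0..y, unsatProb p Δ n s)

theorem continuous_unsatProb (p : ℕ → ℝ) (Δ n : ℕ) : Continuous (unsatProb p Δ n) := by
  induction n with
  | zero => exact continuous_const
  | succ n ih =>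
    exact (continuous_rate p Δ).comp
      (intervalIntegral.continuous_primitive (μ := volume) (fun a b => ih.intervalIntegrable a b) 0)

/-- The root is not saturated before `y` in the process run up to generation `n`, for all large
`n`. -/
def UnsatLim (a : TreeData) (y : ℝ) : Prop := ∃ N, ∀ n, N ≤ n → Unsat n a y

theorem measurableSet_unsatLim : MeasurableSet {q : TreeData × ℝ | UnsatLim q.1 q.2} := by
  simp only [UnsatLim, Set.ofPred_exists, Set.ofPred_forall]
  exact .iUnion fun N => .iInter fun n => .iInter fun _ => measurableSet_unsat n

theorem measurableSet_unsatLim_left (y : ℝ) : MeasurableSet {a : TreeData | UnsatLim a y} :=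
  (measurable_prodMk_right : Measurable fun a : TreeData => (a, y)) measurableSet_unsatLim

theorem IsGood.eventually_unsat_iff {a : TreeData} (ha : IsGood a) {E : Set Edge}
    (hE : IsRDCP (label a) (constraint a) E) (y : ℝ) :
    ∀ᶠ n in atTop, (Unsat n a y ↔ degreeBefore (label a) E [] y < constraint a []) := by
  obtain ⟨N, hN⟩ := ha.exists_not_decPath [] y
  filter_upwards [eventually_ge_atTop N] with n hn
  exact unsat_iff ha hE (v := []) (fun h => hN (h.anti hn)) (by simp)

theorem IsGood.unsatLim_iff {a : TreeData} (ha : IsGood a) {E : Set Edge}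
    (hE : IsRDCP (label a) (constraint a) E) (y : ℝ) :
    UnsatLim a y ↔ degreeBefore (label a) E [] y < constraint a [] := by
  obtain ⟨N, hN⟩ := eventually_atTop.1 (ha.eventually_unsat_iff hE y)
  exact ⟨fun ⟨M, hM⟩ => (hN (max M N) (le_max_right _ _)).1 (hM _ (le_max_left _ _)),
    fun h => ⟨N, fun n hn => (hN n hn).2 h⟩⟩

theorem IsGood.phantomSaturationTime_lt_iff {a : TreeData} (ha : IsGood a)
    (hd : 0 < constraint a []) (y : ℝ≥0) :
    phantomSaturationTime (label a) (constraint a) [] < y ↔ ¬ UnsatLim a y := by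
  obtain ⟨E, hE, -⟩ := existsUnique_isRDCP ha.wellFounded (constraint a)
  rw [PWIT.phantomSaturationTime_lt_iff ha hd hE, ha.unsatLim_iff hE]

section Law

variable {p : ℕ → ℝ} {Δ : ℕ} (hp : IsDegreeDistribution p Δ) (π : Measure ℕ)
  [IsProbabilityMeasure π] (hπ : ∀ k, π {k} = ENNReal.ofReal (p k))
include hp hπ

theorem measureReal_unsat (n : ℕ) {y : ℝ} (hy : 0 ≤ y) :
    (treeLaw π).real {a | Unsat n a y} = unsatProb p Δ n y := by
  induction n generalizing y with
  | zero => simp [Unsat, unsatProb]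
  | succ n ih =>
    have hH : 0 ≤ ∫ s in 0..y, unsatProb p Δ n s := intervalIntegral.integral_nonneg hy
      fun s hs => ih hs.1 ▸ measureReal_nonneg
    have h := measure_root_encard_lt π (measurableSet_unsat n) (continuous_unsatProb p Δ n)
      (fun x hx => ih hx) hy
    simp_rw [hπ] at h
    rw [hp.tsum_eq_rate hH] at h
    rw [unsatProb, ← ENNReal.toReal_ofReal (hp.rate_pos hH).le, ← h]
    rfl

/-- On a good tree the truncated event is eventually constant in `n`, so the indicators converge
almost surely. -/
theorem tendsto_unsatProb {y : ℝ} (hy : 0 ≤ y) : Tendsto (fun n => unsatProb p Δ n y) atTop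
    (𝓝 ((treeLaw π).real {a | UnsatLim a y})) := by
  simp_rw [← fun n => measureReal_unsat hp π hπ n hy]
  refine (ENNReal.tendsto_toReal (measure_ne_top _ _)).comp
    (tendsto_measure_of_ae_tendsto_indicator_of_isFiniteMeasure atTop
      (measurableSet_unsatLim_left y) (fun n => ?_) ?_)
  · exact (measurable_prodMk_right : Measurable fun a : TreeData => (a, y)) (measurableSet_unsat n)
  · filter_upwards [ae_isGood π] with a ha
    obtain ⟨E, hE, -⟩ := existsUnique_isRDCP ha.wellFounded (constraint a)
    filter_upwards [ha.eventually_unsat_iff hE y] with n hn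
    exact hn.trans (ha.unsatLim_iff hE y).symm

/-- The integral `lam` of the probability that the root is not saturated solves the initial value
problem. -/
theorem exists_solvesIntegral : ∃ lam : ℝ → ℝ, SolvesIntegral p Δ lam ∧
    ∀ y, 0 ≤ y → (treeLaw π).real {a | UnsatLim a y} = rate p Δ (lam y) := by
  set G : ℝ → ℝ := fun y => (treeLaw π).real {a | UnsatLim a y}
  have hGm : Measurable G :=
    (measurable_measure_prodMk_right measurableSet_unsatLim).ennreal_toReal
  have hG0 : ∀ y, 0 ≤ G y := fun y => measureReal_nonneg
  have hGi : ∀ a b, IntervalIntegrable G volume a b := fun a b =>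
    (intervalIntegrable_const (c := (1 : ℝ))).mono_fun' hGm.aestronglyMeasurable
      (ae_of_all _ fun y => by
        simp only [Real.norm_of_nonneg (hG0 y)]; exact measureReal_le_one)
  have hcont : Continuous fun y => ∫ s in 0..y, G s :=
    intervalIntegral.continuous_primitive hGi 0
  have hrate : ∀ y, 0 ≤ y → G y = rate p Δ (∫ s in 0..y, G s) := by
    intro y hy
    -- Pass to the limit in `unsatProb (n + 1) = rate (∫ unsatProb n)`; everything is dominated by
    -- `1`.
    refine tendsto_nhds_unique ((tendsto_unsatProb hp π hπ hy).comp (tendsto_add_atTop_nat 1)) ?_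
    refine ((continuous_rate p Δ).tendsto _).comp ?_
    refine intervalIntegral.tendsto_integral_filter_of_dominated_convergence (fun _ => 1)
      (Eventually.of_forall fun n => (continuous_unsatProb p Δ n).aestronglyMeasurable)
      (Eventually.of_forall fun n => ae_of_all _ fun s hs => ?_) intervalIntegrable_const
      (ae_of_all _ fun s hs => ?_)
    · rw [uIoc_of_le hy] at hs
      rw [← measureReal_unsat hp π hπ n hs.1.le, Real.norm_of_nonneg measureReal_nonneg]
      exact measureReal_le_one
    · rw [uIoc_of_le hy] at hs
      exact tendsto_unsatProb hp π hπ hs.1.le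
  have hc : Continuous fun s => rate p Δ (∫ u in 0..s, G u) := (continuous_rate p Δ).comp hcont
  have heq : ∀ t, 0 ≤ t → ∫ s in 0..t, rate p Δ (∫ u in 0..s, G u) = ∫ s in 0..t, G s := by
    intro t ht
    refine intervalIntegral.integral_congr fun s hs => ?_
    rw [uIcc_of_le ht] at hs
    exact (hrate s hs.1).symm
  -- This agrees with `∫ G` for `t ≥ 0`, but its integrand is continuous on the whole line, which
  -- gives a two-sided derivative even at `0`.
  refine ⟨fun t => ∫ s in 0..t, rate p Δ (∫ u in 0..s, G u), ⟨?_, ?_, ?_, ?_⟩, ?_⟩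
  · exact intervalIntegral.continuous_primitive (fun a b => hc.intervalIntegrable a b) 0
  · intro t ht
    rw [heq t ht]
    exact intervalIntegral.integral_nonneg ht fun s _ => hG0 s
  · intro t ht
    have := intervalIntegral.integral_hasDerivAt_right (hc.intervalIntegrable 0 t)
      (hc.stronglyMeasurableAtFilter volume (𝓝 t)) hc.continuousAt
    rwa [heq t ht]
  · intro t ht
    refine intervalIntegral.integral_congr fun s hs => ?_
    rw [uIcc_of_le ht] at hs
    simp only [heq s hs.1]
  · intro y hy
    simp only [heq y hy]
    exact hrate y hy

end Law

/-! ### The decorated tree of the random input -/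

variable {Ω : Type*} {d : Vertex → Ω → ℕ} {τ : Vertex → ℕ → Ω → ℝ}

/-- The increments of a sequence. -/
def increment (t : ℕ → ℝ) : ℕ → ℝ
  | 0 => t 0
  | j + 1 => t (j + 1) - t j

theorem arrival_increment (t : ℕ → ℝ) (j : ℕ) : arrival (increment t) j = t j := by
  induction j with
  | zero => simp [arrival, increment]
  | succ j ih =>
    rw [arrival, Finset.sum_range_succ]
    change arrival (increment t) j + (t (j + 1) - t j) = _
    rw [ih]; ring

theorem measurable_increment : Measurable increment :=
  measurable_pi_lambda _ fun j => by
    cases j with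
    | zero => exact measurable_pi_apply 0
    | succ j => exact (measurable_pi_apply (j + 1)).sub (measurable_pi_apply j)

theorem increment_eq_waitingTime (σ : ℕ → Ω → ℝ) (ω : Ω) :
    increment (fun j => σ j ω) = fun j => waitingTime σ j ω := by
  funext j; cases j <;> rfl

/-- The decorated tree determined by the random input. -/
def treeData (d : Vertex → Ω → ℕ) (τ : Vertex → ℕ → Ω → ℝ) (ω : Ω) : TreeData :=
  fun v => (d v ω, increment fun j => τ v j ω)

theorem label_treeData (ω : Ω) : label (treeData d τ ω) = fun e => τ e.1 e.2 ω :=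
  funext fun e => arrival_increment (fun j => τ e.1 j ω) e.2

variable [MeasurableSpace Ω] {P : Measure Ω} {p : ℕ → ℝ}

theorem IsUnitPPP.map_increment [IsProbabilityMeasure P] {σ : ℕ → Ω → ℝ} (hσ : IsUnitPPP σ P) :
    P.map (fun ω => increment fun j => σ j ω) = Measure.infinitePi fun _ => expMeasure 1 := by
  have hm : ∀ j, Measurable (waitingTime σ j) := fun j => by
    cases j with
    | zero => exact hσ.measurable 0
    | succ j => exact (hσ.measurable (j + 1)).sub (hσ.measurable j)
  simp_rw [increment_eq_waitingTime]
  rw [(iIndepFun_iff_map_fun_eq_infinitePi_map hm).1 hσ.indep]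
  simp_rw [hσ.law]

section RandomTree

variable [IsProbabilityMeasure P] (hτ : IsDecoratedPWIT p d τ P)
include hτ

omit [IsProbabilityMeasure P] in
theorem IsDecoratedPWIT.measurable_node (v : Vertex) :
    Measurable fun ω => (d v ω, fun j => τ v j ω) :=
  (hτ.measurable_d v).prodMk (measurable_pi_lambda _ (hτ.ppp v).measurable)

omit [IsProbabilityMeasure P] in
theorem IsDecoratedPWIT.measurable_treeData : Measurable (treeData d τ) :=
  measurable_pi_lambda _ fun v => (hτ.measurable_d v).prodMk
    (measurable_increment.comp (hτ.measurable_node v).snd)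

/-- Transfers every almost sure statement and every probability from the abstract space to
`treeLaw`. -/
theorem IsDecoratedPWIT.map_treeData : P.map (treeData d τ) = treeLaw (P.map (d [])) := by
  have hg : Measurable fun x : ℕ × (ℕ → ℝ) => (x.1, increment x.2) :=
    measurable_fst.prodMk (measurable_increment.comp measurable_snd)
  have hind : iIndepFun (fun v ω => treeData d τ ω v) P :=
    hτ.indep.comp (fun _ x => (x.1, increment x.2)) fun _ => hg
  have h := (iIndepFun_iff_map_fun_eq_infinitePi_map
    (fun v => (measurable_pi_apply v).comp hτ.measurable_treeData)).1 hind
  refine h.trans ?_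
  rw [treeLaw]
  congr 1
  funext v
  have h2 : IndepFun (d v) (fun ω => increment fun j => τ v j ω) P :=
    (hτ.indep_vertex v).comp measurable_id measurable_increment
  have hm2 : Measurable fun ω => increment fun j => τ v j ω :=
    measurable_increment.comp (hτ.measurable_node v).snd
  have h3 := h2.map_prod_eq_prod_map_map (hτ.measurable_d v).aemeasurable hm2.aemeasurable
  refine h3.trans ?_
  rw [(hτ.ppp v).map_increment, nodeLaw]
  congr 1
  refine Measure.ext_of_singleton fun k => ?_
  rw [Measure.map_apply (hτ.measurable_d v) (measurableSet_singleton k),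
    Measure.map_apply (hτ.measurable_d []) (measurableSet_singleton k), hτ.law_d, hτ.law_d]

theorem IsDecoratedPWIT.ae_isGood : ∀ᵐ ω ∂P, IsGood (treeData d τ ω) := by
  have : IsProbabilityMeasure (P.map (d [])) :=
    Measure.isProbabilityMeasure_map (hτ.measurable_d []).aemeasurable
  have h := PWIT.ae_isGood (P.map (d []))
  rw [← hτ.map_treeData] at h
  exact ae_of_ae_map hτ.measurable_treeData.aemeasurable h

theorem IsDecoratedPWIT.ae_existsUnique :
    ∀ᵐ ω ∂P, ∃! E : Set Edge, IsRDCP (fun e => τ e.1 e.2 ω) (fun v => d v ω) E := by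
  filter_upwards [hτ.ae_isGood] with ω hω
  have := existsUnique_isRDCP hω.wellFounded (constraint (treeData d τ ω))
  rwa [label_treeData] at this

variable {Δ : ℕ} (hp : IsDegreeDistribution p Δ)
include hp

theorem IsDecoratedPWIT.ae_phantomTime_lt_iff :
    ∀ᵐ ω ∂P, ∀ y : ℝ≥0, phantomTime d τ [] ω < y ↔ ¬ UnsatLim (treeData d τ ω) y := by
  -- A zero constraint would give saturation time `0`, and the equivalence would fail at `y = 0`.
  have h0 : ∀ᵐ ω ∂P, d [] ω ≠ 0 := by
    rw [ae_iff]
    have := hτ.law_d [] 0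
    rw [hp.lower 0 (by norm_num), ENNReal.ofReal_zero] at this
    simpa [preimage] using this
  filter_upwards [hτ.ae_isGood, h0] with ω hω hd y
  have := hω.phantomSaturationTime_lt_iff (Nat.pos_of_ne_zero hd) y
  rwa [label_treeData] at this

theorem IsDecoratedPWIT.aemeasurable_phantomTime : AEMeasurable (phantomTime d τ []) P := by
  classical
  -- The measurable version is the infimum of the rationals `r`, cut off at `0`, by which the root
  -- has saturated.
  refine ⟨fun ω => ⨅ r : ℚ, if UnsatLim (treeData d τ ω) (Real.toNNReal r) then ⊤ else
    (Real.toNNReal r : ℝ≥0∞), ?_, ?_⟩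
  · exact .iInf fun r => Measurable.ite
      (hτ.measurable_treeData (measurableSet_unsatLim_left _)) measurable_const measurable_const
  · filter_upwards [hτ.ae_phantomTime_lt_iff hp] with ω hω
    refine le_antisymm (le_iInf fun r => ?_) (le_of_forall_gt fun x hx => ?_)
    · split_ifs with h
      · exact le_top
      · exact ((hω _).2 h).le
    · obtain ⟨r, -, h1, h2⟩ := ENNReal.lt_iff_exists_rat_btwn.1 hx
      refine (iInf_le _ r).trans_lt ?_
      rwa [if_neg ((hω _).1 h1)]

theorem IsDecoratedPWIT.exists_solution : ∃ lam : ℝ → ℝ, SolvesIntegral p Δ lam ∧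
    ∀ y : ℝ≥0, P {ω | (y : ℝ≥0∞) ≤ phantomTime d τ [] ω} = ENNReal.ofReal (rate p Δ (lam y)) := by
  have hprob : IsProbabilityMeasure (P.map (d [])) :=
    Measure.isProbabilityMeasure_map (hτ.measurable_d []).aemeasurable
  obtain ⟨lam, hl, hlam⟩ := exists_solvesIntegral hp (P.map (d [])) fun k => by
    rw [Measure.map_apply (hτ.measurable_d []) (measurableSet_singleton k), hτ.law_d]
  refine ⟨lam, hl, fun y => ?_⟩
  rw [← hlam y y.2, measureReal_def, ENNReal.ofReal_toReal (measure_ne_top _ _),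
    ← hτ.map_treeData, Measure.map_apply hτ.measurable_treeData (measurableSet_unsatLim_left y)]
  refine measure_congr ?_
  filter_upwards [hτ.ae_phantomTime_lt_iff hp] with ω hω
  refine propext ?_
  change (y : ℝ≥0∞) ≤ phantomTime d τ [] ω ↔ UnsatLim (treeData d τ ω) y
  rw [← not_lt, hω, not_not]

end RandomTree

end PWIT

/-! ### From the tail of the saturation time to its mean and density -/

theorem mainTheorem5 {Ω : Type*} [MeasurableSpace Ω] (P : Measure Ω) [IsProbabilityMeasure P]
    (p : ℕ → ℝ) (Δ : ℕ) (hp : PWIT.IsDegreeDistribution p Δ)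
    (d : PWIT.Vertex → Ω → ℕ) (τ : PWIT.Vertex → ℕ → Ω → ℝ)
    (hτ : PWIT.IsDecoratedPWIT p d τ P) :
    -- the process is almost surely well defined
    (∀ᵐ ω ∂P, ∃! E : Set PWIT.Edge,
      PWIT.IsRDCP (fun e => τ e.1 e.2 ω) (fun v => d v ω) E) ∧
    -- the phantom saturation time of the root is an a.s. finite random variable of infinite mean
    AEMeasurable (PWIT.phantomTime d τ []) P ∧
    (∀ᵐ ω ∂P, PWIT.phantomTime d τ [] ω < ⊤) ∧
    (∫⁻ ω, PWIT.phantomTime d τ [] ω ∂P) = ⊤ ∧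
    -- the initial value problem has a unique solution `lam` on `[0, ∞)`, and the density is `f`
    ∃ lam f : ℝ → ℝ,
      PWIT.SolvesIVP p Δ lam ∧
      (∀ mu : ℝ → ℝ, PWIT.SolvesIVP p Δ mu → EqOn mu lam (Ici 0)) ∧
      P.map (fun ω => (PWIT.phantomTime d τ [] ω).toReal) =
        (volume.restrict (Ici (0 : ℝ))).withDensity (fun t => ENNReal.ofReal (f t)) ∧
      ∀ t, 0 ≤ t →
        HasDerivWithinAt (derivWithin lam (Ici 0)) (-f t) (Ici 0) t ∧
        f t = derivWithin lam (Ici 0) t * Real.exp (-lam t) *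
          ∑' k : ℕ, lam t ^ k / (k.factorial : ℝ) * p (k + 1) ∧
        f t = derivWithin lam (Ici 0) t * ∑' k : ℕ, PWIT.z p lam t k := by
  have hT := hτ.aemeasurable_phantomTime hp
  obtain ⟨lam, hl, htail⟩ := hτ.exists_solution hp
  have hfin : ∀ᵐ ω ∂P, PWIT.phantomTime d τ [] ω < ⊤ := by
    rw [ae_iff]
    -- The event `T = ∞` lies in every `T ≥ n`, whose probability `rate p Δ (lam n)` tends to `0`.
    refine le_antisymm (ge_of_tendsto' (x := Filter.atTop) (f := fun n : ℕ =>
      ENNReal.ofReal (PWIT.rate p Δ (lam n))) ?_ fun n => ?_) zero_le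
    · have := (ENNReal.tendsto_ofReal (hl.tendsto_rate hp)).comp tendsto_natCast_atTop_atTop
      rwa [ENNReal.ofReal_zero] at this
    · rw [← NNReal.coe_natCast n, ← htail n]
      exact measure_mono fun ω hω => le_top.trans (not_lt.1 hω)
  have htail' : ∀ a : ℝ, 0 ≤ a → P {ω | a ≤ (PWIT.phantomTime d τ [] ω).toReal} =
      ENNReal.ofReal (PWIT.rate p Δ (lam a)) := by
    intro a ha
    lift a to ℝ≥0 using ha
    rw [← htail a]
    refine measure_congr ?_
    filter_upwards [hfin] with ω hω
    refine propext ?_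
    change (a : ℝ) ≤ (PWIT.phantomTime d τ [] ω).toReal ↔ (a : ℝ≥0∞) ≤ PWIT.phantomTime d τ [] ω
    rw [← ENNReal.ofReal_le_iff_le_toReal hω.ne, ENNReal.ofReal_coe_nnreal]
  refine ⟨hτ.ae_existsUnique, hT, hfin, ?_, lam, fun t => PWIT.rate p Δ (lam t) * Real.exp (-lam t) *
      ∑' k : ℕ, lam t ^ k / (k.factorial : ℝ) * p (k + 1), hl.solvesIVP,
      fun mu hmu => hl.solvesIVP.eqOn hmu, ?_, fun t ht => ⟨?_, ?_, ?_⟩⟩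
  · have h1 : ∫⁻ ω, PWIT.phantomTime d τ [] ω ∂P =
        ∫⁻ ω, ENNReal.ofReal (PWIT.phantomTime d τ [] ω).toReal ∂P := by
      refine lintegral_congr_ae ?_
      filter_upwards [hfin] with ω hω
      rw [ENNReal.ofReal_toReal hω.ne]
    -- Layer cake: the mean is the integral of the tail `lam'`, which diverges.
    rw [h1, lintegral_eq_lintegral_meas_le P (ae_of_all _ fun _ => ENNReal.toReal_nonneg)
      hT.ennreal_toReal, ← hl.lintegral_rate_eq_top hp]
    exact setLIntegral_congr_fun measurableSet_Ioi fun t ht => htail' t (le_of_lt ht)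
  · have hprob : IsProbabilityMeasure (P.map fun ω => (PWIT.phantomTime d τ [] ω).toReal) :=
      Measure.isProbabilityMeasure_map hT.ennreal_toReal
    refine Measure.ext_of_Ici _ _ fun a => ?_
    rw [Measure.map_apply_of_aemeasurable hT.ennreal_toReal measurableSet_Ici,
      withDensity_apply _ measurableSet_Ici, Measure.restrict_restrict measurableSet_Ici]
    rcases le_or_gt 0 a with ha | ha
    · rw [inter_eq_left.2 (Ici_subset_Ici.2 ha), hl.lintegral_density hp ha, ← htail' a ha]
      rfl
    -- Neither measure charges negative numbers, so `a < 0` reduces to the tail at `0`.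
    · rw [inter_eq_right.2 (Ici_subset_Ici.2 ha.le), hl.lintegral_density hp le_rfl,
        ← htail' 0 le_rfl]
      congr 1
      ext ω
      simp [ha.le.trans ENNReal.toReal_nonneg]
  · exact (hl.hasDerivAt_rate_comp hp ht).hasDerivWithinAt.congr (fun s hs => hl.derivWithin hs)
      (hl.derivWithin ht)
  · rw [hl.derivWithin ht]
  · beta_reduce
    rw [hl.derivWithin ht, mul_assoc, ← tsum_mul_left]
    simp only [PWIT.z, mul_assoc]
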